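/- All algebra is over $\mathbb{Q}$ and gradings are over $\mathbb{Z}$. A DGL is a differential graded Lie algebra with differential $\partial$ of degree $-1$; it is formal if a finite zig-zag of DGL quasi-isomorphisms joins it to its homology $H_*(L)$, with the induced bracket and zero differential. Let $k\ge 2$ and $n_1,\dots,n_k\in\mathbb{Z}$. Let $\mathbb{L}(U)$ be the DGL whose underlying graded Lie algebra is free on generators $u_I$, for $\emptyset\ne I\subsetneq\{1,\dots,k\}$, of degree $|u_I|=\sum_{i\in I}n_i-1$, with $$\partial u_I=\sum_{J}\varepsilon(J,I\setminus J)\,(-1)^{|u_J|}\,[u_J,u_{I\setminus J}],$$ where $J$ runs over the proper subsets of $I$ that contain $\min I$, and $\varepsilon(J,K)=\prod_{j\in J,\,i\in K,\,i<j}(-1)^{n_jn_i}$ is the Koszul sign. Let $w\in\mathbb{L}(U)$, of degree $n_1+\dots+n_k-2$, be the cycle given by the same formula for $I=\{1,\dots,k\}$. For a DGL $L$, classes $x_i\in H_{n_i-1}(L)$ and cycles $a_i\in L$ representing $x_i$ ($1\le i\le k$), the $k$-th order Whitehead bracket set is $$[x_1,\dots,x_k]=\{\overline{\phi(w)}\mid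 \phi:\mathbb{L}(U)\to L \text{ a DGL morphism with } \phi(u_{\{i\}})=a_i \text{ for all } i\}\subseteq H_{n_1+\dots+n_k-2}(L).$$ Theorem. Let $L$ be a DGL, $k\ge2$, $x_i\in H_{n_i-1}(L)$ for $1\le i\le k$, and suppose that, for some choice of cycles $a_i$ representing the $x_i$, the set $[x_1,\dots,x_k]$ (computed with this choice) is non-empty. Let $[x_1,\dots,x_k]'$ be the Whitehead bracket set of $x_1,\dots,x_k$ computed in the DGL $H=H_*(L)$ with zero differential, where each $x_i$ is its own representative. Then $L$ is not formal if one of the following conditions holds: 1. $k\ge3$ and $0\notin[x_1,\dots,x_k]$; 2. the sets $[x_1,\dots,x_k]$ and $[x_1,\dots,x_k]'$ are not in bijection. -/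

import Mathlib

universe u v

/-- A `ℤ`-graded Lie algebra over `ℚ`.  The component of degree `n` is `obj n`.  The bracket takes
the target degree `p` together with a proof of `m + n = p`, so that no casts are needed. -/
structure GradedLie : Type (u + 1) where
  obj : ℤ → Type u
  [addCommGroup : ∀ n, AddCommGroup (obj n)]
  [module : ∀ n, Module ℚ (obj n)]
  bracket : ∀ {m n p : ℤ}, m + n = p → obj m →ₗ[ℚ] obj n →ₗ[ℚ] obj p
  antisymm : ∀ {m n p : ℤ} (h : m + n = p) (x : obj m) (y : obj n),
    bracket h x y = -((-1 : ℚ) ^ (m * n) • bracket ((add_comm n m).trans h) y x)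
  jacobi : ∀ {l m n lm mn ln p : ℤ} (hlm : l + m = lm) (hmn : m + n = mn) (hln : l + n = ln)
    (h₁ : l + mn = p) (h₂ : lm + n = p) (h₃ : m + ln = p) (x : obj l) (y : obj m) (z : obj n),
    bracket h₁ x (bracket hmn y z) =
      bracket h₂ (bracket hlm x y) z + (-1 : ℚ) ^ (l * m) • bracket h₃ y (bracket hln x z)

attribute [instance] GradedLie.addCommGroup GradedLie.module

/-- A differential graded Lie algebra over `ℚ`, graded over `ℤ`, with differential of degree `-1`. -/
structure DGL : Type (u + 1) extends GradedLie.{u} where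
  d : ∀ m n : ℤ, n + 1 = m → obj m →ₗ[ℚ] obj n
  d_d : ∀ {l m n : ℤ} (h : m + 1 = l) (h' : n + 1 = m) (x : obj l), d m n h' (d l m h x) = 0
  leibniz : ∀ {m n p m' n' p' : ℤ} (h : m + n = p) (hm : m' + 1 = m) (hn : n' + 1 = n)
    (hp : p' + 1 = p) (h₁ : m' + n = p') (h₂ : m + n' = p') (x : obj m) (y : obj n),
    d p p' hp (bracket h x y) =
      bracket h₁ (d m m' hm x) y + (-1 : ℚ) ^ m • bracket h₂ x (d n n' hn y)

namespace DGL

/-- Morphisms of DGLs: degree-zero linear maps commuting with brackets and differentials. -/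
structure Hom (A : DGL.{u}) (B : DGL.{v}) where
  map : ∀ n, A.obj n →ₗ[ℚ] B.obj n
  map_bracket : ∀ {m n p : ℤ} (h : m + n = p) (x : A.obj m) (y : A.obj n),
    map p (A.bracket h x y) = B.bracket h (map m x) (map n y)
  map_d : ∀ {m n : ℤ} (h : n + 1 = m) (x : A.obj m), map n (A.d m n h x) = B.d m n h (map m x)

section Homology

/-- Cycles of degree `n`. -/
def cycles (L : DGL.{u}) (n : ℤ) : Submodule ℚ (L.obj n) :=
  LinearMap.ker (L.d n (n - 1) (sub_add_cancel n 1))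

/-- Boundaries of degree `n`. -/
def boundaries (L : DGL.{u}) (n : ℤ) : Submodule ℚ (L.obj n) :=
  LinearMap.range (L.d (n + 1) n rfl)

/-- The homology `H_n(L)`: cycles modulo boundaries. -/
abbrev H (L : DGL.{u}) (n : ℤ) : Type u :=
  L.cycles n ⧸ (L.boundaries n).submoduleOf (L.cycles n)

/-- The homology class of a cycle. -/
def cls (L : DGL.{u}) {n : ℤ} : L.cycles n →ₗ[ℚ] L.H n :=
  Submodule.mkQ _

theorem mem_cycles {L : DGL.{u}} {m : ℤ} (n : ℤ) (h : n + 1 = m) (x : L.obj m) :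
    x ∈ L.cycles m ↔ L.d m n h x = 0 := by
  obtain rfl : n = m - 1 := by omega
  rfl

theorem mem_boundaries {L : DGL.{u}} {n : ℤ} (m : ℤ) (h : n + 1 = m) (x : L.obj n) :
    x ∈ L.boundaries n ↔ ∃ y, L.d m n h y = x := by
  subst h
  rfl

theorem bracket_mem_cycles (L : DGL.{u}) {m n p : ℤ} (h : m + n = p) {x : L.obj m} {y : L.obj n}
    (hx : x ∈ L.cycles m) (hy : y ∈ L.cycles n) : L.bracket h x y ∈ L.cycles p := by
  rw [mem_cycles (p - 1) (by omega)]
  rw [mem_cycles (m - 1) (by omega)] at hx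
  rw [mem_cycles (n - 1) (by omega)] at hy
  rw [L.leibniz h (m' := m - 1) (n' := n - 1) (by omega) (by omega) (by omega) (by omega)
    (by omega), hx, hy]
  simp

theorem bracket_mem_boundaries_right (L : DGL.{u}) {m n p : ℤ} (h : m + n = p) {x : L.obj m}
    {y : L.obj n} (hx : x ∈ L.cycles m) (hy : y ∈ L.boundaries n) :
    L.bracket h x y ∈ L.boundaries p := by
  rw [mem_boundaries (p + 1) rfl]
  rw [mem_boundaries (n + 1) rfl] at hy
  rw [mem_cycles (m - 1) (by omega)] at hx
  obtain ⟨z, rfl⟩ := hy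
  refine ⟨(-1 : ℚ) ^ m • L.bracket (by omega) x z, ?_⟩
  rw [map_smul, L.leibniz (m := m) (n := n + 1) (by omega) (m' := m - 1) (n' := n) (by omega)
    (by omega) (by omega) (by omega) h, hx]
  simp only [map_zero, LinearMap.zero_apply, zero_add, smul_smul]
  rw [← mul_zpow]
  simp

theorem bracket_mem_boundaries_left (L : DGL.{u}) {m n p : ℤ} (h : m + n = p) {x : L.obj m}
    {y : L.obj n} (hx : x ∈ L.boundaries m) (hy : y ∈ L.cycles n) :
    L.bracket h x y ∈ L.boundaries p := by
  rw [L.antisymm]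
  exact neg_mem (Submodule.smul_mem _ _ (L.bracket_mem_boundaries_right _ hy hx))

/-- The bracket of two cycles, as a homology class. -/
def cyclesBracket (L : DGL.{u}) {m n p : ℤ} (h : m + n = p) :
    L.cycles m →ₗ[ℚ] L.cycles n →ₗ[ℚ] L.H p :=
  LinearMap.mk₂ ℚ
    (fun x y => L.cls ⟨L.bracket h x.1 y.1, L.bracket_mem_cycles h x.2 y.2⟩)
    (fun x x' y => by rw [← map_add]; congr 1; ext; simp)
    (fun c x y => by rw [← map_smul]; congr 1; ext; simp)
    (fun x y y' => by rw [← map_add]; congr 1; ext; simp)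
    (fun c x y => by rw [← map_smul]; congr 1; ext; simp)

theorem cls_eq_zero (L : DGL.{u}) {n : ℤ} (x : L.cycles n) :
    L.cls x = 0 ↔ x.1 ∈ L.boundaries n := by
  unfold cls
  rw [Submodule.mkQ_apply, Submodule.Quotient.mk_eq_zero]
  rfl

/-- The bracket induced on homology. -/
def homologyBracket (L : DGL.{u}) {m n p : ℤ} (h : m + n = p) :
    L.H m →ₗ[ℚ] L.H n →ₗ[ℚ] L.H p :=
  Submodule.liftQ _
    (LinearMap.flip (Submodule.liftQ _ (L.cyclesBracket h).flip (by
      intro y hy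
      rw [LinearMap.mem_ker]
      ext x
      exact (L.cls_eq_zero _).2 (L.bracket_mem_boundaries_right h x.2 hy))))
    (by
      intro x hx
      rw [LinearMap.mem_ker]
      ext y
      exact (L.cls_eq_zero _).2 (L.bracket_mem_boundaries_left h hx y.2))

theorem homologyBracket_cls (L : DGL.{u}) {m n p : ℤ} (h : m + n = p) (x : L.cycles m)
    (y : L.cycles n) : L.homologyBracket h (L.cls x) (L.cls y) =
      L.cls ⟨L.bracket h x.1 y.1, L.bracket_mem_cycles h x.2 y.2⟩ := rfl

theorem cls_surjective (L : DGL.{u}) {n : ℤ} (c : L.H n) : ∃ x, L.cls x = c :=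
  Submodule.mkQ_surjective _ c

/-- The homology `H_*(L)`, with the induced bracket and zero differential. -/
def homologyDGL (L : DGL.{u}) : DGL.{u} where
  obj := L.H
  bracket := L.homologyBracket
  antisymm h x y := by
    obtain ⟨x, rfl⟩ := L.cls_surjective x
    obtain ⟨y, rfl⟩ := L.cls_surjective y
    rw [homologyBracket_cls, homologyBracket_cls, ← map_smul, ← map_neg]
    congr 1
    ext
    exact L.antisymm h _ _
  jacobi hlm hmn hln h₁ h₂ h₃ x y z := by
    obtain ⟨x, rfl⟩ := L.cls_surjective x
    obtain ⟨y, rfl⟩ := L.cls_surjective y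
    obtain ⟨z, rfl⟩ := L.cls_surjective z
    simp only [homologyBracket_cls]
    rw [← map_smul, ← map_add]
    congr 1
    ext
    exact L.jacobi hlm hmn hln h₁ h₂ h₃ _ _ _
  d _ _ _ := 0
  d_d _ _ _ := rfl
  leibniz _ _ _ _ _ _ _ _ := by simp

theorem Hom.map_mem_cycles {A : DGL.{u}} {B : DGL.{v}} (f : Hom A B) {n : ℤ} {x : A.obj n}
    (hx : x ∈ A.cycles n) : f.map n x ∈ B.cycles n := by
  rw [mem_cycles (n - 1) (by omega)] at *
  rw [← f.map_d, hx, map_zero]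

/-- The map induced by a morphism on homology. -/
def Hom.mapH {A : DGL.{u}} {B : DGL.{v}} (f : Hom A B) (n : ℤ) : A.H n →ₗ[ℚ] B.H n :=
  Submodule.mapQ _ _ ((f.map n).restrict (fun _ hx => f.map_mem_cycles hx)) (by
    intro x hx
    obtain ⟨y, hy⟩ := (mem_boundaries (n + 1) rfl x.1).1 hx
    exact (mem_boundaries (n + 1) rfl (f.map n x.1)).2
      ⟨f.map (n + 1) y, by rw [← f.map_d, hy]⟩)

/-- Quasi-isomorphisms. -/
def Hom.IsQuasiIso {A : DGL.{u}} {B : DGL.{v}} (f : Hom A B) : Prop :=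
  ∀ n, Function.Bijective (f.mapH n)

/-- `L` is formal if a finite zig-zag of DGL quasi-isomorphisms joins `L` to `H_*(L)` with zero
differential. -/
def IsFormal (L : DGL.{u}) : Prop :=
  Relation.EqvGen (fun A B : DGL.{u} => ∃ f : Hom A B, f.IsQuasiIso) L L.homologyDGL

end Homology

end DGL

namespace FreeLie

/-- Formal expressions of each degree in generators `x : X` of degree `deg x`. -/
inductive Pre (X : Type u) (deg : X → ℤ) : ℤ → Type u
  | of (x : X) {n : ℤ} (h : deg x = n) : Pre X deg n
  | zero {n : ℤ} : Pre X deg n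
  | add {n : ℤ} (a b : Pre X deg n) : Pre X deg n
  | neg {n : ℤ} (a : Pre X deg n) : Pre X deg n
  | smul {n : ℤ} (c : ℚ) (a : Pre X deg n) : Pre X deg n
  | br {m n p : ℤ} (h : m + n = p) (a : Pre X deg m) (b : Pre X deg n) : Pre X deg p

/-- The congruence on formal expressions generated by the axioms of graded Lie algebras. -/
inductive Rel (X : Type u) (deg : X → ℤ) : ∀ {n : ℤ}, Pre X deg n → Pre X deg n → Prop
  | refl {n : ℤ} (a : Pre X deg n) : Rel X deg a a
  | symm {n : ℤ} {a b : Pre X deg n} : Rel X deg a b → Rel X deg b a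
  | trans {n : ℤ} {a b c : Pre X deg n} : Rel X deg a b → Rel X deg b c → Rel X deg a c
  | add_congr {n : ℤ} {a a' b b' : Pre X deg n} :
      Rel X deg a a' → Rel X deg b b' → Rel X deg (.add a b) (.add a' b')
  | neg_congr {n : ℤ} {a a' : Pre X deg n} : Rel X deg a a' → Rel X deg (.neg a) (.neg a')
  | smul_congr {n : ℤ} (c : ℚ) {a a' : Pre X deg n} :
      Rel X deg a a' → Rel X deg (.smul c a) (.smul c a')
  | br_congr {m n p : ℤ} (h : m + n = p) {a a' : Pre X deg m} {b b' : Pre X deg n} :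
      Rel X deg a a' → Rel X deg b b' → Rel X deg (.br h a b) (.br h a' b')
  | add_assoc {n : ℤ} (a b c : Pre X deg n) :
      Rel X deg (.add (.add a b) c) (.add a (.add b c))
  | add_comm {n : ℤ} (a b : Pre X deg n) : Rel X deg (.add a b) (.add b a)
  | zero_add {n : ℤ} (a : Pre X deg n) : Rel X deg (.add .zero a) a
  | neg_add {n : ℤ} (a : Pre X deg n) : Rel X deg (.add (.neg a) a) .zero
  | one_smul {n : ℤ} (a : Pre X deg n) : Rel X deg (.smul 1 a) a
  | mul_smul {n : ℤ} (c c' : ℚ) (a : Pre X deg n) :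
      Rel X deg (.smul (c * c') a) (.smul c (.smul c' a))
  | smul_add {n : ℤ} (c : ℚ) (a b : Pre X deg n) :
      Rel X deg (.smul c (.add a b)) (.add (.smul c a) (.smul c b))
  | add_smul {n : ℤ} (c c' : ℚ) (a : Pre X deg n) :
      Rel X deg (.smul (c + c') a) (.add (.smul c a) (.smul c' a))
  | br_add_left {m n p : ℤ} (h : m + n = p) (a a' : Pre X deg m) (b : Pre X deg n) :
      Rel X deg (.br h (.add a a') b) (.add (.br h a b) (.br h a' b))
  | br_smul_left {m n p : ℤ} (h : m + n = p) (c : ℚ) (a : Pre X deg m) (b : Pre X deg n) :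
      Rel X deg (.br h (.smul c a) b) (.smul c (.br h a b))
  | br_add_right {m n p : ℤ} (h : m + n = p) (a : Pre X deg m) (b b' : Pre X deg n) :
      Rel X deg (.br h a (.add b b')) (.add (.br h a b) (.br h a b'))
  | br_smul_right {m n p : ℤ} (h : m + n = p) (c : ℚ) (a : Pre X deg m) (b : Pre X deg n) :
      Rel X deg (.br h a (.smul c b)) (.smul c (.br h a b))
  | antisymm {m n p : ℤ} (h : m + n = p) (h' : n + m = p) (a : Pre X deg m) (b : Pre X deg n) :
      Rel X deg (.br h a b) (.neg (.smul ((-1 : ℚ) ^ (m * n)) (.br h' b a)))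
  | jacobi {l m n lm mn ln p : ℤ} (hlm : l + m = lm) (hmn : m + n = mn) (hln : l + n = ln)
      (h₁ : l + mn = p) (h₂ : lm + n = p) (h₃ : m + ln = p)
      (a : Pre X deg l) (b : Pre X deg m) (c : Pre X deg n) :
      Rel X deg (.br h₁ a (.br hmn b c))
        (.add (.br h₂ (.br hlm a b) c)
          (.smul ((-1 : ℚ) ^ (l * m)) (.br h₃ b (.br hln a c))))

variable {X : Type u} {deg : X → ℤ}

instance preSetoid (X : Type u) (deg : X → ℤ) (n : ℤ) : Setoid (Pre X deg n) where
  r := Rel X deg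
  iseqv := ⟨Rel.refl, Rel.symm, Rel.trans⟩

/-- The degree `n` component of the free graded Lie algebra. -/
def Obj (X : Type u) (deg : X → ℤ) (n : ℤ) : Type u := Quotient (preSetoid X deg n)

/-- The class of a formal expression. -/
def mk {n : ℤ} (a : Pre X deg n) : Obj X deg n := Quotient.mk _ a

theorem mk_surjective {n : ℤ} (x : Obj X deg n) : ∃ a, mk a = x := Quotient.exists_rep x

theorem mk_eq {n : ℤ} {a b : Pre X deg n} (h : Rel X deg a b) : mk a = mk b := Quotient.sound h

instance (n : ℤ) : Zero (Obj X deg n) := ⟨mk .zero⟩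

instance (n : ℤ) : Add (Obj X deg n) :=
  ⟨Quotient.map₂ .add (fun _ _ h _ _ h' => .add_congr h h')⟩

instance (n : ℤ) : Neg (Obj X deg n) := ⟨Quotient.map .neg (fun _ _ h => .neg_congr h)⟩

instance (n : ℤ) : AddCommGroup (Obj X deg n) where
  add_assoc := by rintro ⟨a⟩ ⟨b⟩ ⟨c⟩; exact mk_eq (.add_assoc a b c)
  add_comm := by rintro ⟨a⟩ ⟨b⟩; exact mk_eq (.add_comm a b)
  zero_add := by rintro ⟨a⟩; exact mk_eq (.zero_add a)
  add_zero := by rintro ⟨a⟩; exact mk_eq (.trans (.add_comm _ _) (.zero_add a))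
  neg_add_cancel := by rintro ⟨a⟩; exact mk_eq (.neg_add a)
  nsmul := nsmulRec
  zsmul := zsmulRec

instance (n : ℤ) : SMul ℚ (Obj X deg n) where
  smul c := Quotient.map (.smul c) (fun _ _ h => .smul_congr c h)

instance (n : ℤ) : Module ℚ (Obj X deg n) :=
  Module.ofMinimalAxioms
    (by rintro c ⟨a⟩ ⟨b⟩; exact mk_eq (.smul_add c a b))
    (by rintro c c' ⟨a⟩; exact mk_eq (.add_smul c c' a))
    (by rintro c c' ⟨a⟩; exact mk_eq (.mul_smul c c' a))
    (by rintro ⟨a⟩; exact mk_eq (.one_smul a))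

/-- The bracket of the free graded Lie algebra. -/
def brk {m n p : ℤ} (h : m + n = p) : Obj X deg m →ₗ[ℚ] Obj X deg n →ₗ[ℚ] Obj X deg p :=
  LinearMap.mk₂ ℚ (Quotient.map₂ (.br h) (fun _ _ h₁ _ _ h₂ => .br_congr h h₁ h₂))
    (by rintro ⟨a⟩ ⟨a'⟩ ⟨b⟩; exact mk_eq (.br_add_left h a a' b))
    (by rintro c ⟨a⟩ ⟨b⟩; exact mk_eq (.br_smul_left h c a b))
    (by rintro ⟨a⟩ ⟨b⟩ ⟨b'⟩; exact mk_eq (.br_add_right h a b b'))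
    (by rintro c ⟨a⟩ ⟨b⟩; exact mk_eq (.br_smul_right h c a b))

/-- The free graded Lie algebra over `ℚ` on a graded set of generators. -/
def free (X : Type u) (deg : X → ℤ) : GradedLie.{u} where
  obj := Obj X deg
  bracket := brk
  antisymm := by rintro m n p h ⟨a⟩ ⟨b⟩; exact mk_eq (.antisymm h _ a b)
  jacobi := by
    rintro l m n lm mn ln p hlm hmn hln h₁ h₂ h₃ ⟨a⟩ ⟨b⟩ ⟨c⟩
    exact mk_eq (.jacobi hlm hmn hln h₁ h₂ h₃ a b c)

theorem brk_antisymm {m n p : ℤ} (h : m + n = p) (h' : n + m = p) (x : Obj X deg m)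
    (y : Obj X deg n) : brk h x y = -((-1 : ℚ) ^ (m * n) • brk h' y x) :=
  (free X deg).antisymm h x y

theorem brk_jacobi {l m n lm mn ln p : ℤ} (hlm : l + m = lm) (hmn : m + n = mn) (hln : l + n = ln)
    (h₁ : l + mn = p) (h₂ : lm + n = p) (h₃ : m + ln = p) (x : Obj X deg l) (y : Obj X deg m)
    (z : Obj X deg n) : brk h₁ x (brk hmn y z) =
      brk h₂ (brk hlm x y) z + (-1 : ℚ) ^ (l * m) • brk h₃ y (brk hln x z) :=
  (free X deg).jacobi hlm hmn hln h₁ h₂ h₃ x y z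

/-- The degree `-1` derivation with prescribed values `D` on generators, on formal expressions. -/
def preDer (D : ∀ (x : X) (q : ℤ), q + 1 = deg x → Obj X deg q) :
    ∀ {p : ℤ}, Pre X deg p → ∀ q : ℤ, q + 1 = p → Obj X deg q
  | _, .of x h => fun q hq => D x q (hq.trans h.symm)
  | _, .zero => fun _ _ => 0
  | _, .add a b => fun q hq => preDer D a q hq + preDer D b q hq
  | _, .neg a => fun q hq => -preDer D a q hq
  | _, .smul c a => fun q hq => c • preDer D a q hq
  | _, .br (m := m) (n := n) h a b => fun q hq =>
      brk (show m - 1 + n = q by omega) (preDer D a (m - 1) (by omega)) (mk b) +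
        (-1 : ℚ) ^ m • brk (show m + (n - 1) = q by omega) (mk a) (preDer D b (n - 1) (by omega))

theorem sign_eq (n : ℤ) : (-1 : ℚ) ^ n = if Even n then 1 else -1 := by
  split_ifs with h
  · exact h.neg_one_zpow
  · exact (Int.not_even_iff_odd.1 h).neg_one_zpow

theorem mk_add {n : ℤ} (a b : Pre X deg n) : mk (.add a b) = mk a + mk b := rfl
theorem mk_neg {n : ℤ} (a : Pre X deg n) : mk (.neg a) = -mk a := rfl
theorem mk_smul {n : ℤ} (c : ℚ) (a : Pre X deg n) : mk (.smul c a) = c • mk a := rfl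
theorem mk_br {m n p : ℤ} (h : m + n = p) (a : Pre X deg m) (b : Pre X deg n) :
    mk (.br h a b) = brk h (mk a) (mk b) := rfl

theorem preDer_congr (D : ∀ (x : X) (q : ℤ), q + 1 = deg x → Obj X deg q) {p : ℤ}
    {a b : Pre X deg p} (hab : Rel X deg a b) (q : ℤ) (hq : q + 1 = p) :
    preDer D a q hq = preDer D b q hq := by
  induction hab generalizing q with
  | refl => rfl
  | symm _ ih => exact (ih _ _).symm
  | trans _ _ ih ih' => exact (ih _ _).trans (ih' _ _)
  | add_congr _ _ ih ih' => simp only [preDer, ih, ih']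
  | neg_congr _ ih => simp only [preDer, ih]
  | smul_congr _ _ ih => simp only [preDer, ih]
  | br_congr _ h h' ih ih' => simp only [preDer, ih, ih', mk_eq h, mk_eq h']
  | add_assoc => exact add_assoc _ _ _
  | add_comm => exact add_comm _ _
  | zero_add => exact zero_add _
  | neg_add => exact neg_add_cancel _
  | one_smul => exact one_smul _ _
  | mul_smul => exact mul_smul _ _ _
  | smul_add => exact smul_add _ _ _
  | add_smul => exact add_smul _ _ _
  | br_add_left =>
    simp only [preDer, mk_add, map_add, LinearMap.add_apply, smul_add]
    abel
  | br_smul_left =>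
    simp only [preDer, mk_smul, map_smul, LinearMap.smul_apply, smul_add]
    congr 1
    exact smul_comm _ _ _
  | br_add_right =>
    simp only [preDer, mk_add, map_add, smul_add]
    abel
  | br_smul_right =>
    simp only [preDer, mk_smul, map_smul, smul_add]
    congr 1
    exact smul_comm _ _ _
  | @antisymm m n p h h' a b =>
    simp only [preDer]
    rw [brk_antisymm (show m - 1 + n = q by omega) (show n + (m - 1) = q by omega),
      brk_antisymm (show m + (n - 1) = q by omega) (show n - 1 + m = q by omega)]
    simp only [sign_eq]
    by_cases hm : Even m <;> by_cases hn : Even n <;>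
      simp [hm, hn, Int.even_mul, ← Int.not_even_iff_odd]
  | @jacobi l m n lm mn ln p hlm hmn hln h₁ h₂ h₃ a b c =>
    simp only [preDer, mk_br, map_add, map_smul, LinearMap.add_apply, LinearMap.smul_apply]
    rw [brk_jacobi (lm := lm - 1) (ln := ln - 1) (by omega) hmn (by omega) (by omega) (by omega)
        (by omega) (preDer D a (l - 1) _),
      brk_jacobi (lm := lm - 1) (ln := ln) (by omega) (show m - 1 + n = mn - 1 by omega) (by omega)
        (by omega) (by omega) (by omega) (mk a),
      brk_jacobi (lm := lm) (ln := ln - 1) (by omega) (show m + (n - 1) = mn - 1 by omega)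
        (by omega) (by omega) (by omega) (by omega) (mk a)]
    simp only [sign_eq, ← hlm]
    by_cases hl : Even l <;> by_cases hm : Even m <;>
      simp [hl, hm, Int.even_mul, Int.even_add, ← Int.not_even_iff_odd] <;> abel

/-- The degree `-1` derivation of the free graded Lie algebra with prescribed values `D` on
generators. -/
def der (D : ∀ (x : X) (q : ℤ), q + 1 = deg x → Obj X deg q) (p q : ℤ) (hq : q + 1 = p) :
    Obj X deg p →ₗ[ℚ] Obj X deg q where
  toFun := Quotient.lift (fun a => preDer D a q hq) (fun _ _ h => preDer_congr D h q hq)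
  map_add' := by rintro ⟨a⟩ ⟨b⟩; rfl
  map_smul' := by rintro c ⟨a⟩; rfl

theorem der_mk (D : ∀ (x : X) (q : ℤ), q + 1 = deg x → Obj X deg q) {p : ℤ} (q : ℤ)
    (hq : q + 1 = p) (a : Pre X deg p) : der D p q hq (mk a) = preDer D a q hq := rfl

theorem der_leibniz (D : ∀ (x : X) (q : ℤ), q + 1 = deg x → Obj X deg q)
    {m n p m' n' p' : ℤ} (h : m + n = p) (hm : m' + 1 = m) (hn : n' + 1 = n)
    (hp : p' + 1 = p) (h₁ : m' + n = p') (h₂ : m + n' = p') (x : Obj X deg m) (y : Obj X deg n) :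
    der D p p' hp (brk h x y) =
      brk h₁ (der D m m' hm x) y + (-1 : ℚ) ^ m • brk h₂ x (der D n n' hn y) := by
  obtain rfl : m' = m - 1 := by omega
  obtain rfl : n' = n - 1 := by omega
  obtain ⟨a, rfl⟩ := mk_surjective x
  obtain ⟨b, rfl⟩ := mk_surjective y
  rfl

theorem der_der (D : ∀ (x : X) (q : ℤ), q + 1 = deg x → Obj X deg q)
    (hD : ∀ (x : X) (q r : ℤ) (hq : q + 1 = deg x) (hr : r + 1 = q), der D q r hr (D x q hq) = 0)
    {p q r : ℤ} (hq : q + 1 = p) (hr : r + 1 = q) (x : Obj X deg p) :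
    der D q r hr (der D p q hq x) = 0 := by
  obtain ⟨a, rfl⟩ := mk_surjective x
  induction a generalizing q r with
  | of x h => exact hD _ _ _ _ _
  | zero => exact map_zero _
  | add a b ih ih' => rw [mk_add, map_add, map_add, ih, ih', add_zero]
  | neg a ih => rw [mk_neg, map_neg, map_neg, ih, neg_zero]
  | smul c a ih => rw [mk_smul, map_smul, map_smul, ih, smul_zero]
  | @br m n p h a b ih ih' =>
    rw [mk_br, der_leibniz D h (m' := m - 1) (n' := n - 1) (by omega) (by omega) (by omega)
      (by omega) (by omega), map_add, map_smul,
      der_leibniz D (m := m - 1) (m' := m - 2) (n' := n - 1) (by omega) (by omega) (by omega)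
        (by omega) (by omega) (by omega),
      der_leibniz D (n := n - 1) (m' := m - 1) (n' := n - 2) (by omega) (by omega) (by omega)
        (by omega) (by omega) (by omega), ih, ih']
    simp only [map_zero, LinearMap.zero_apply, smul_zero, add_zero, zero_add, sign_eq]
    by_cases hm : Even m <;> simp [hm, ← Int.not_even_iff_odd]

/-- The free graded Lie algebra with the derivation determined by `D`, as a DGL. -/
def freeDGL (X : Type u) (deg : X → ℤ) (D : ∀ (x : X) (q : ℤ), q + 1 = deg x → Obj X deg q)
    (hD : ∀ (x : X) (q r : ℤ) (hq : q + 1 = deg x) (hr : r + 1 = q),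
      der D q r hr (D x q hq) = 0) : DGL.{u} where
  toGradedLie := free X deg
  d := der D
  d_d := fun h h' x => der_der D hD h h' x
  leibniz := der_leibniz D

end FreeLie

namespace Whitehead

open FreeLie

variable {k : ℕ}

/-- `∑_{i ∈ I} n_i - 1`, the degree of `u_I`. -/
def gdeg (n : Fin k → ℤ) (I : Finset (Fin k)) : ℤ := ∑ i ∈ I, n i - 1

/-- The index set of the generators `u_I`: nonempty proper subsets `I = {i₁ < ⋯ < i_s}` of
`{1, …, k}`. -/
abbrev Gen (k : ℕ) : Type := {I : Finset (Fin k) // I.Nonempty ∧ I ≠ Finset.univ}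

/-- The components of the free graded Lie algebra `𝕃(U)` on the generators `u_I`. -/
abbrev LU (n : Fin k → ℤ) : ℤ → Type := Obj (Gen k) (fun I => gdeg n I.1)

/-- The generator `u_I`, in the degree `p = |u_I|`. -/
def gen (n : Fin k → ℤ) (I : Gen k) {p : ℤ} (h : gdeg n I.1 = p) :
    LU n p := mk (.of I h)

/-- The Koszul sign of the shuffle rearranging `I = J ⊔ K` into (`J` in increasing order, followed
by `K` in increasing order), where the letter `i` has degree `n_i`: a factor `(-1)^(n_j n_i)` for
each inversion. -/
def koszul (n : Fin k → ℤ) (J K : Finset (Fin k)) : ℚ :=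
  ∏ j ∈ J, ∏ i ∈ K, if i < j then (-1 : ℚ) ^ (n j * n i) else 1

/-- The shuffles of `I` fixing its first element, each recorded by its first block `J`: proper
subsets `J` of `I` containing the least element of `I`. -/
def splits (I : Finset (Fin k)) : Finset (Finset (Fin k)) :=
  I.powerset.filter (fun J => J ≠ I ∧ ∃ i ∈ J, ∀ j ∈ I, i ≤ j)

theorem left_mem {I J : Finset (Fin k)} (h : J ∈ splits I) : J.Nonempty ∧ J ≠ Finset.univ := by
  simp only [splits, Finset.mem_filter, Finset.mem_powerset] at h
  obtain ⟨h₁, h₂, i, hi, -⟩ := h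
  refine ⟨⟨i, hi⟩, fun h => h₂ (Finset.Subset.antisymm h₁ ?_)⟩
  rw [h]
  exact Finset.subset_univ _

theorem right_mem {I J : Finset (Fin k)} (h : J ∈ splits I) :
    (I \ J).Nonempty ∧ I \ J ≠ Finset.univ := by
  simp only [splits, Finset.mem_filter, Finset.mem_powerset] at h
  obtain ⟨h₁, h₂, i, hi, -⟩ := h
  refine ⟨Finset.sdiff_nonempty.2 (fun h => h₂ (Finset.Subset.antisymm h₁ h)), fun h => ?_⟩
  have := Finset.mem_univ i
  rw [← h] at this
  exact (Finset.mem_sdiff.1 this).2 hi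

theorem splits_empty : splits (∅ : Finset (Fin k)) = ∅ := by
  refine Finset.eq_empty_of_forall_notMem fun J hJ => ?_
  obtain ⟨h, h', -⟩ := Finset.mem_filter.1 hJ
  exact h' (Finset.subset_empty.1 (Finset.mem_powerset.1 h))

theorem gdeg_sdiff (n : Fin k → ℤ) {I J : Finset (Fin k)} (h : J ⊆ I) :
    gdeg n J + gdeg n (I \ J) = gdeg n I - 1 := by
  have := Finset.sum_sdiff (f := n) h
  unfold gdeg
  omega

theorem subset_of_mem {I J : Finset (Fin k)} (h : J ∈ splits I) : J ⊆ I :=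
  Finset.mem_powerset.1 (Finset.mem_filter.1 h).1

/-- The element `∑_J ± [u_J, u_{I ∖ J}]`, of degree `q = |u_I| - 1`. -/
def bdry (n : Fin k → ℤ) (I : Finset (Fin k)) (q : ℤ) (hq : q + 1 = gdeg n I) :
    LU n q :=
  ∑ J ∈ (splits I).attach, (koszul n J.1 (I \ J.1) * (-1 : ℚ) ^ gdeg n J.1) •
    brk (show gdeg n J.1 + gdeg n (I \ J.1) = q by
        rw [gdeg_sdiff n (subset_of_mem J.2)]; omega)
      (gen n ⟨J.1, left_mem J.2⟩ rfl) (gen n ⟨I \ J.1, right_mem J.2⟩ rfl)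

section SquareZero

variable (n : Fin k → ℤ)

open Classical in
/-- The generator `u_I`, extended by zero to all `I`. -/
def tot (I : Finset (Fin k)) : LU n (gdeg n I) :=
  if h : I.Nonempty ∧ I ≠ Finset.univ then gen n ⟨I, h⟩ rfl else 0

theorem tot_empty : tot n ∅ = 0 := by simp [tot]

/-- The bracket into degree `q`, extended by zero. -/
def br0 (q : ℤ) {a b : ℤ} (x : LU n a)
    (y : LU n b) : LU n q :=
  if h : a + b = q then brk h x y else 0

theorem br0_eq {q a b : ℤ} (h : a + b = q) (x : LU n a) (y : LU n b) : br0 n q x y = brk h x y :=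
  dif_pos h

theorem koszul_union {A B C : Finset (Fin k)} (h : Disjoint A B) :
    koszul n (A ∪ B) C = koszul n A C * koszul n B C := by
  unfold koszul
  exact Finset.prod_union h

theorem koszul_sq (A B : Finset (Fin k)) : koszul n A B * koszul n A B = 1 := by
  unfold koszul
  simp only [← Finset.prod_mul_distrib]
  refine Finset.prod_eq_one fun i _ => Finset.prod_eq_one fun j _ => ?_
  split_ifs
  · rw [← mul_zpow]; simp
  · simp

theorem prod_sign {ι : Type*} (s : Finset ι) (f : ι → ℤ) :
    ∏ i ∈ s, (-1 : ℚ) ^ f i = (-1) ^ ∑ i ∈ s, f i := by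
  classical
  induction s using Finset.induction_on with
  | empty => simp
  | insert a s ha ih => rw [Finset.prod_insert ha, Finset.sum_insert ha, zpow_add₀ (by simp), ih]

theorem koszul_mul_swap {A B : Finset (Fin k)} (h : Disjoint A B) :
    koszul n A B * koszul n B A = (-1 : ℚ) ^ ((∑ i ∈ A, n i) * ∑ i ∈ B, n i) := by
  unfold koszul
  rw [Finset.prod_comm (s := B), ← Finset.prod_mul_distrib]
  simp only [← Finset.prod_mul_distrib]
  rw [Finset.sum_mul, ← prod_sign]
  refine Finset.prod_congr rfl fun i hi => ?_
  rw [Finset.mul_sum, ← prod_sign]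
  refine Finset.prod_congr rfl fun j hj => ?_
  have hij : i ≠ j := fun e => Finset.disjoint_left.1 h hi (e ▸ hj)
  rcases lt_or_gt_of_ne hij with h' | h'
  · rw [if_neg h'.not_gt, if_pos h', one_mul, mul_comm]
  · rw [if_pos h', if_neg h'.not_gt, mul_one]

theorem koszul_swap {A B : Finset (Fin k)} (h : Disjoint A B) :
    koszul n B A = (-1 : ℚ) ^ ((gdeg n A + 1) * (gdeg n B + 1)) * koszul n A B := by
  have h₁ := koszul_mul_swap n h
  have h₂ := koszul_sq n A B
  have e : (gdeg n A + 1) * (gdeg n B + 1) = (∑ i ∈ A, n i) * ∑ i ∈ B, n i := by simp [gdeg]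
  rw [e, ← h₁]
  linear_combination -(koszul n B A) * h₂

/-- The coefficient of `[u_J, u_K]`. -/
def coef (J K : Finset (Fin k)) : ℚ := koszul n J K * (-1 : ℚ) ^ gdeg n J

theorem coef_swap {J K : Finset (Fin k)} (h : Disjoint J K) :
    coef n K J = -((-1 : ℚ) ^ (gdeg n J * gdeg n K) * coef n J K) := by
  unfold coef
  rw [koszul_swap n h]
  simp only [sign_eq]
  by_cases hj : Even (gdeg n J) <;> by_cases hk : Even (gdeg n K) <;>
    simp [hj, hk, Int.even_mul]

theorem coef_br0_swap (q : ℤ) {J K : Finset (Fin k)} (h : Disjoint J K) :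
    coef n J K • br0 n q (tot n J) (tot n K) = coef n K J • br0 n q (tot n K) (tot n J) := by
  rw [coef_swap n h]
  by_cases hq : gdeg n J + gdeg n K = q
  · rw [br0_eq n hq, br0_eq n ((add_comm _ _).trans hq),
      brk_antisymm hq ((add_comm _ _).trans hq)]
    module
  · rw [br0, br0, dif_neg hq, dif_neg (fun h => hq ((add_comm _ _).trans h))]
    simp

theorem bdry_eq (I : Finset (Fin k)) (q : ℤ) (hq : q + 1 = gdeg n I) :
    (2 : ℚ) • bdry n I q hq =
      ∑ J ∈ I.powerset, coef n J (I \ J) • br0 n q (tot n J) (tot n (I \ J)) := by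
  classical
  set f : Finset (Fin k) → LU n q :=
    fun J => coef n J (I \ J) • br0 n q (tot n J) (tot n (I \ J)) with hf
  have h₁ : bdry n I q hq = ∑ J ∈ splits I, f J := by
    rw [← Finset.sum_attach, bdry]
    refine Finset.sum_congr rfl fun J _ => ?_
    have e : gdeg n J.1 + gdeg n (I \ J.1) = q := by
      rw [gdeg_sdiff n (subset_of_mem J.2)]; omega
    rw [hf]
    dsimp only
    rw [br0_eq n e, tot, tot, dif_pos (left_mem J.2), dif_pos (right_mem J.2), coef]
  have f0 : f ∅ = 0 := by
    rw [hf]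
    simp only [br0, tot_empty]
    split_ifs <;> simp
  have fI : f I = 0 := by
    rw [hf]
    dsimp only
    rw [Finset.sdiff_self, br0]
    split_ifs
    · rw [tot_empty, map_zero, smul_zero]
    · simp
  have fs : ∀ J ⊆ I, f (I \ J) = f J := by
    intro J hJ
    rw [hf]
    dsimp only
    rw [Finset.sdiff_sdiff_eq_self hJ]
    exact coef_br0_swap n q Finset.sdiff_disjoint
  rcases I.eq_empty_or_nonempty with rfl | hI
  · rw [h₁, splits_empty]
    simp [f0]
  let P : Finset (Fin k) → Prop := fun J => I.min' hI ∈ J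
  have h₂ : ∑ J ∈ splits I, f J = ∑ J ∈ I.powerset with P J, f J := by
    refine Finset.sum_subset (fun J hJ => ?_) (fun J hJ hJ' => ?_)
    · simp only [splits, Finset.mem_filter] at hJ ⊢
      obtain ⟨hJ, -, i, hi, hi'⟩ := hJ
      have : i = I.min' hI :=
        le_antisymm (hi' _ (I.min'_mem hI)) (I.min'_le _ (Finset.mem_powerset.1 hJ hi))
      exact ⟨hJ, by rwa [this] at hi⟩
    · simp only [splits, Finset.mem_filter] at hJ hJ'
      by_cases e : J = I
      · rw [e, fI]
      · exact absurd ⟨hJ.1, e, _, hJ.2, fun j hj => I.min'_le _ hj⟩ hJ'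
  have h₃ : ∑ J ∈ I.powerset with ¬ P J, f J = ∑ J ∈ I.powerset with P J, f J := by
    refine Finset.sum_nbij' (fun J => I \ J) (fun J => I \ J) ?_ ?_ ?_ ?_ ?_
    · intro J hJ
      simp only [Finset.mem_filter, Finset.mem_powerset, P] at hJ ⊢
      exact ⟨Finset.sdiff_subset, Finset.mem_sdiff.2 ⟨I.min'_mem hI, hJ.2⟩⟩
    · intro J hJ
      simp only [Finset.mem_filter, Finset.mem_powerset, P] at hJ ⊢
      exact ⟨Finset.sdiff_subset, fun h => (Finset.mem_sdiff.1 h).2 hJ.2⟩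
    · intro J hJ
      exact Finset.sdiff_sdiff_eq_self (Finset.mem_powerset.1 (Finset.mem_filter.1 hJ).1)
    · intro J hJ
      exact Finset.sdiff_sdiff_eq_self (Finset.mem_powerset.1 (Finset.mem_filter.1 hJ).1)
    · intro J hJ
      exact (fs J (Finset.mem_powerset.1 (Finset.mem_filter.1 hJ).1)).symm
  rw [← Finset.sum_filter_add_sum_filter_not I.powerset P, h₃, ← h₂, ← h₁, two_smul]

/-- The derivation `∂` of the free graded Lie algebra on the `u_I`. -/
abbrev del (p q : ℤ) (hq : q + 1 = p) :
    LU n p →ₗ[ℚ] LU n q :=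
  der (fun I => bdry n I.1) p q hq

theorem bdry_empty (q : ℤ) (hq : q + 1 = gdeg n (∅ : Finset (Fin k))) : bdry n ∅ q hq = 0 := by
  unfold bdry
  rw [Finset.sum_eq_zero]
  rintro ⟨J, hJ⟩
  rw [splits_empty] at hJ
  exact absurd hJ (Finset.notMem_empty _)

theorem del_tot {I : Finset (Fin k)} (hI : I ≠ Finset.univ) (q : ℤ) (hq : q + 1 = gdeg n I) :
    del n _ q hq (tot n I) = bdry n I q hq := by
  classical
  by_cases h : I.Nonempty
  · rw [tot, dif_pos ⟨h, hI⟩]; rfl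
  · obtain rfl := Finset.not_nonempty_iff_eq_empty.1 h
    rw [tot_empty, map_zero, bdry_empty]

/-- Ordered decompositions of `I` into three disjoint blocks. -/
def triples (I : Finset (Fin k)) : Finset (Finset (Fin k) × Finset (Fin k) × Finset (Fin k)) :=
  Finset.univ.filter fun t => Disjoint t.1 t.2.1 ∧ Disjoint t.1 t.2.2 ∧ Disjoint t.2.1 t.2.2 ∧
    t.1 ∪ t.2.1 ∪ t.2.2 = I

/-- The summand `± [[u_A, u_B], u_C]`. -/
def trip (r : ℤ) (A B C : Finset (Fin k)) : LU n r :=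
  (coef n (A ∪ B) C * coef n A B) •
    br0 n r (br0 n (gdeg n A + gdeg n B) (tot n A) (tot n B)) (tot n C)

theorem gdeg_union {A B : Finset (Fin k)} (h : Disjoint A B) :
    gdeg n (A ∪ B) = gdeg n A + gdeg n B + 1 := by
  unfold gdeg
  rw [Finset.sum_union h]
  ring

theorem trip_jacobi (r : ℤ) {A B C : Finset (Fin k)} (hr : gdeg n A + gdeg n B + gdeg n C = r)
    (hAB : Disjoint A B) (hAC : Disjoint A C) (hBC : Disjoint B C) :
    trip n r A B C + trip n r B C A + trip n r C A B = 0 := by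
  have hj := brk_jacobi (lm := gdeg n A + gdeg n B) (mn := gdeg n B + gdeg n C)
    (ln := gdeg n A + gdeg n C) (p := r) rfl rfl rfl (by omega) (by omega) (by omega)
    (tot n A) (tot n B) (tot n C)
  rw [brk_antisymm (m := gdeg n A) (n := gdeg n B + gdeg n C) (p := r) (by omega) (by omega),
    brk_antisymm (m := gdeg n B) (n := gdeg n A + gdeg n C) (p := r) (by omega) (by omega),
    brk_antisymm (m := gdeg n A) (n := gdeg n C) rfl (add_comm _ _)] at hj
  have e : ∀ (s t : ℤ) (hs : s = t) (h₁ : gdeg n C + gdeg n A = s) (h₂ : gdeg n C + gdeg n A = t)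
      (h₃ : s + gdeg n B = r) (h₄ : t + gdeg n B = r),
      brk h₃ (brk h₁ (tot n C) (tot n A)) (tot n B) =
        brk h₄ (brk h₂ (tot n C) (tot n A)) (tot n B) := by
    rintro s t rfl _ _ _ _; rfl
  simp only [map_neg, map_smul, LinearMap.neg_apply, LinearMap.smul_apply] at hj
  rw [e _ _ (add_comm (gdeg n A) (gdeg n C)) (add_comm _ _) rfl (by omega) (by omega)] at hj
  unfold trip
  rw [br0_eq n rfl, br0_eq n rfl, br0_eq n rfl, br0_eq n (by omega), br0_eq n (by omega),
    br0_eq n (by omega)]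
  unfold coef
  rw [koszul_union n hAB, koszul_union n hBC, koszul_union n hAC.symm, gdeg_union n hAB,
    gdeg_union n hBC, gdeg_union n hAC.symm, koszul_swap n hAB, koszul_swap n hAC,
    koszul_swap n hBC]
  generalize koszul n A B = κ₁
  generalize koszul n A C = κ₂
  generalize koszul n B C = κ₃
  revert hj
  simp only [sign_eq]
  by_cases ha : Even (gdeg n A) <;> by_cases hb : Even (gdeg n B) <;>
    by_cases hc : Even (gdeg n C) <;>
    simp only [ha, hb, hc, Int.even_mul, Int.even_add, if_true, if_false,
      not_true, or_true, or_false, iff_true,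
      iff_false, Int.not_even_one] <;>
    intro hj
  all_goals first
    | linear_combination (norm := module) (κ₁ * κ₂ * κ₃) • hj
    | linear_combination (norm := module) (-(κ₁ * κ₂ * κ₃)) • hj

theorem br0_zero_right (r : ℤ) {a b : ℤ} (x : LU n a) : br0 n r x (0 : LU n b) = 0 := by
  unfold br0
  split_ifs <;> simp

theorem br0_zero_left (r : ℤ) {a b : ℤ} (x : LU n b) : br0 n r (0 : LU n a) x = 0 := by
  unfold br0
  split_ifs <;> simp

theorem br0_br0 (r q : ℤ) {a b c : ℤ} (h : a + b = q) (x : LU n a) (y : LU n b) (z : LU n c) :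
    br0 n r (br0 n q x y) z = br0 n r (br0 n (a + b) x y) z := by
  subst h; rfl

/-- The summand `± [∂u_J, u_K]`. -/
def half (r : ℤ) (J K : Finset (Fin k)) : LU n r :=
  coef n J K • br0 n r (bdry n J (gdeg n J - 1) (by omega)) (tot n K)

theorem del_br0 {J K : Finset (Fin k)} (hd : Disjoint J K) {q r : ℤ} (hr : r + 1 = q)
    (hq : gdeg n J + gdeg n K = q) :
    coef n J K • del n q r hr (br0 n q (tot n J) (tot n K)) = half n r J K + half n r K J := by
  unfold half
  by_cases hJ : J = ∅
  · subst hJ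
    rw [tot_empty, bdry_empty, br0_zero_left, br0_zero_right, br0_zero_left]
    simp
  by_cases hK : K = ∅
  · subst hK
    rw [tot_empty, bdry_empty, br0_zero_left, br0_zero_right, br0_zero_right]
    simp
  have hJ' : J ≠ Finset.univ := by
    rintro rfl
    exact hK (Finset.eq_empty_of_forall_notMem fun x hx =>
      Finset.disjoint_left.1 hd (Finset.mem_univ x) hx)
  have hK' : K ≠ Finset.univ := by
    rintro rfl
    exact hJ (Finset.eq_empty_of_forall_notMem fun x hx =>
      Finset.disjoint_left.1 hd hx (Finset.mem_univ x))
  rw [br0_eq n hq, der_leibniz _ hq (m' := gdeg n J - 1) (n' := gdeg n K - 1) (by omega) (by omega)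
    hr (by omega) (by omega), del_tot n hJ', del_tot n hK', br0_eq n (by omega),
    br0_eq n (by omega), coef_swap n hd,
    brk_antisymm (m := gdeg n J) (n := gdeg n K - 1) (by omega) (by omega)]
  simp only [sign_eq]
  by_cases ha : Even (gdeg n J) <;> by_cases hb : Even (gdeg n K) <;>
    simp [ha, hb, Int.even_mul, ← Int.not_even_iff_odd]

theorem two_half {I J : Finset (Fin k)} (r : ℤ) :
    (2 : ℚ) • half n r J (I \ J) = ∑ A ∈ J.powerset, trip n r A (J \ A) (I \ J) := by
  by_cases h : gdeg n J - 1 + gdeg n (I \ J) = r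
  · unfold half
    rw [br0_eq n h, smul_comm, ← LinearMap.map_smul₂, bdry_eq, map_sum,
      LinearMap.sum_apply, Finset.smul_sum]
    refine Finset.sum_congr rfl fun A hA => ?_
    have hA := Finset.mem_powerset.1 hA
    unfold trip
    rw [Finset.union_sdiff_of_subset hA, map_smul, LinearMap.smul_apply, ← br0_eq n h,
      br0_br0 n r _ (gdeg_sdiff n hA), smul_smul]
  · unfold half
    rw [br0, dif_neg h, smul_zero, smul_zero]
    refine (Finset.sum_eq_zero fun A hA => ?_).symm
    have := gdeg_sdiff n (Finset.mem_powerset.1 hA)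
    unfold trip
    rw [br0, dif_neg (by omega), smul_zero]

theorem sum_triples (I : Finset (Fin k)) {M : Type*} [AddCommMonoid M]
    (f : Finset (Fin k) → Finset (Fin k) → Finset (Fin k) → M) :
    ∑ J ∈ I.powerset, ∑ A ∈ J.powerset, f A (J \ A) (I \ J) =
      ∑ t ∈ triples I, f t.1 t.2.1 t.2.2 := by
  rw [Finset.sum_sigma']
  refine Finset.sum_bij' (fun s _ => (s.2, s.1 \ s.2, I \ s.1)) (fun t _ => ⟨t.1 ∪ t.2.1, t.1⟩)
    ?_ ?_ ?_ ?_ ?_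
  · rintro ⟨J, A⟩ h
    simp only [Finset.mem_sigma, Finset.mem_powerset] at h
    obtain ⟨hJ, hA⟩ := h
    simp only [triples, Finset.mem_filter, Finset.mem_univ, true_and]
    refine ⟨Finset.disjoint_sdiff, ?_, ?_, ?_⟩
    · exact Finset.disjoint_of_subset_left hA Finset.disjoint_sdiff
    · exact Finset.disjoint_of_subset_left Finset.sdiff_subset Finset.disjoint_sdiff
    · rw [Finset.union_sdiff_of_subset hA, Finset.union_sdiff_of_subset hJ]
  · rintro ⟨A, B, C⟩ h
    simp only [triples, Finset.mem_filter, Finset.mem_univ, true_and] at h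
    obtain ⟨-, -, -, rfl⟩ := h
    simp only [Finset.mem_sigma, Finset.mem_powerset]
    exact ⟨Finset.subset_union_left, Finset.subset_union_left⟩
  · rintro ⟨J, A⟩ h
    simp only [Finset.mem_sigma, Finset.mem_powerset] at h
    simp only [Finset.union_sdiff_of_subset h.2]
  · rintro ⟨A, B, C⟩ h
    simp only [triples, Finset.mem_filter, Finset.mem_univ, true_and] at h
    obtain ⟨h₁, h₂, h₃, rfl⟩ := h
    simp only [Prod.mk.injEq, true_and]
    exact ⟨Finset.union_sdiff_cancel_left h₁,
      Finset.union_sdiff_cancel_left (Finset.disjoint_union_left.2 ⟨h₂, h₃⟩)⟩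
  · rintro ⟨J, A⟩ h
    rfl

theorem sum_rotate (I : Finset (Fin k)) {M : Type*} [AddCommMonoid M]
    (f : Finset (Fin k) → Finset (Fin k) → Finset (Fin k) → M) :
    ∑ t ∈ triples I, f t.2.1 t.2.2 t.1 = ∑ t ∈ triples I, f t.1 t.2.1 t.2.2 := by
  refine Finset.sum_nbij' (fun t => (t.2.1, t.2.2, t.1)) (fun t => (t.2.2, t.1, t.2.1))
    ?_ ?_ ?_ ?_ ?_
  · rintro ⟨A, B, C⟩ h
    simp only [triples, Finset.mem_filter, Finset.mem_univ, true_and] at h ⊢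
    obtain ⟨h₁, h₂, h₃, rfl⟩ := h
    exact ⟨h₃, h₁.symm, h₂.symm, by rw [Finset.union_comm, ← Finset.union_assoc]⟩
  · rintro ⟨A, B, C⟩ h
    simp only [triples, Finset.mem_filter, Finset.mem_univ, true_and] at h ⊢
    obtain ⟨h₁, h₂, h₃, rfl⟩ := h
    exact ⟨h₂.symm, h₃.symm, h₁, by rw [Finset.union_assoc, Finset.union_comm]⟩
  · intro t _; rfl
  · intro t _; rfl
  · intro t _; rfl

theorem del_bdry (I : Finset (Fin k)) (q r : ℤ) (hq : q + 1 = gdeg n I) (hr : r + 1 = q) :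
    del n q r hr (bdry n I q hq) = 0 := by
  have h₁ : (2 : ℚ) • del n q r hr (bdry n I q hq) =
      ∑ J ∈ I.powerset, (half n r J (I \ J) + half n r (I \ J) J) := by
    rw [← map_smul, bdry_eq, map_sum]
    refine Finset.sum_congr rfl fun J hJ => ?_
    rw [map_smul, del_br0 n Finset.disjoint_sdiff hr]
    rw [gdeg_sdiff n (Finset.mem_powerset.1 hJ)]
    omega
  have h₂ : ∑ J ∈ I.powerset, half n r (I \ J) J = ∑ J ∈ I.powerset, half n r J (I \ J) := by
    refine Finset.sum_nbij' (fun J => I \ J) (fun J => I \ J) ?_ ?_ ?_ ?_ ?_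
    · intro J _
      exact Finset.mem_powerset.2 Finset.sdiff_subset
    · intro J _
      exact Finset.mem_powerset.2 Finset.sdiff_subset
    · intro J hJ
      exact Finset.sdiff_sdiff_eq_self (Finset.mem_powerset.1 hJ)
    · intro J hJ
      exact Finset.sdiff_sdiff_eq_self (Finset.mem_powerset.1 hJ)
    · intro J hJ
      rw [Finset.sdiff_sdiff_eq_self (Finset.mem_powerset.1 hJ)]
  have h₃ : (2 : ℚ) • ∑ J ∈ I.powerset, half n r J (I \ J) =
      ∑ t ∈ triples I, trip n r t.1 t.2.1 t.2.2 := by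
    rw [Finset.smul_sum, ← sum_triples I (trip n r)]
    exact Finset.sum_congr rfl fun J _ => two_half n r
  have h₄ : (3 : ℚ) • ∑ t ∈ triples I, trip n r t.1 t.2.1 t.2.2 = 0 := by
    have e₁ := sum_rotate I (trip n r)
    have e₂ := sum_rotate I (fun A B C => trip n r B C A)
    have : ∑ t ∈ triples I, (trip n r t.1 t.2.1 t.2.2 + trip n r t.2.1 t.2.2 t.1 +
        trip n r t.2.2 t.1 t.2.1) = 0 := by
      refine Finset.sum_eq_zero ?_
      rintro ⟨A, B, C⟩ h
      simp only [triples, Finset.mem_filter, Finset.mem_univ, true_and] at h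
      obtain ⟨hAB, hAC, hBC, rfl⟩ := h
      refine trip_jacobi n r ?_ hAB hAC hBC
      change gdeg n A + gdeg n B + gdeg n C = r
      have := gdeg_union n (Finset.disjoint_union_left.2 ⟨hAC, hBC⟩)
      have := gdeg_union n hAB
      omega
    rw [Finset.sum_add_distrib, Finset.sum_add_distrib] at this
    rw [e₂, e₁] at this
    rw [← this]
    module
  rw [Finset.sum_add_distrib, h₂] at h₁
  have h₅ : ∑ t ∈ triples I, trip n r t.1 t.2.1 t.2.2 = 0 :=
    (smul_eq_zero.1 h₄).resolve_left (by norm_num)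
  rw [h₅] at h₃
  rw [(smul_eq_zero.1 h₃).resolve_left (by norm_num), add_zero] at h₁
  exact (smul_eq_zero.1 h₁).resolve_left (by norm_num)

end SquareZero

/-- The DGL `𝕃(U)`: the free graded Lie algebra on the generators `u_I`, of degree
`∑_{i ∈ I} n_i - 1`, with `∂u_I = ∑_J ± [u_J, u_{I ∖ J}]`. -/
def lieU (n : Fin k → ℤ) : DGL :=
  freeDGL (Gen k) (fun I => gdeg n I.1) (fun I => bdry n I.1) (fun I => del_bdry n I.1)

/-- The singleton `{i}` is a proper subset when `k ≥ 2`. -/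
def single (hk : 2 ≤ k) (i : Fin k) : Gen k :=
  ⟨{i}, Finset.singleton_nonempty i, fun h => by
    have := congrArg Finset.card h
    simp at this
    omega⟩

theorem gdeg_single (n : Fin k → ℤ) (hk : 2 ≤ k) (i : Fin k) :
    gdeg n (single hk i).1 = n i - 1 := by
  simp [gdeg, single]

/-- The generator `u_i`, of degree `n_i - 1`. -/
def u (n : Fin k → ℤ) (hk : 2 ≤ k) (i : Fin k) : (lieU n).obj (n i - 1) :=
  gen n (single hk i) (gdeg_single n hk i)

theorem w_degree (n : Fin k → ℤ) : (∑ i, n i) - 2 + 1 = gdeg n Finset.univ := by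
  unfold gdeg; ring

/-- The element `w ∈ 𝕃(U)`, of degree `n_1 + ⋯ + n_k - 2`: the right-hand side of the formula for
`∂u_I` with `I = {1, …, k}` (which is not the index of a generator). -/
def w (n : Fin k → ℤ) : (lieU n).obj ((∑ i, n i) - 2) :=
  bdry n Finset.univ _ (w_degree n)

theorem w_mem_cycles (n : Fin k → ℤ) : w n ∈ (lieU n).cycles ((∑ i, n i) - 2) :=
  del_bdry n Finset.univ _ _ _ _

/-- The `k`-th order Whitehead bracket set computed with the elements `a_i ∈ L_{n_i - 1}`: the
homology classes of `φ(w)`, where `φ` runs over all DGL morphisms `𝕃(U) → L` extending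
`u_i ↦ a_i`.  When `a_i` is a cycle representing `x_i`, this is `[x_1, …, x_k]`. -/
def bracketSet (L : DGL.{u}) (hk : 2 ≤ k) (n : Fin k → ℤ) (a : ∀ i, L.obj (n i - 1)) :
    Set (L.H ((∑ i, n i) - 2)) :=
  {c | ∃ φ : DGL.Hom (lieU n) L, (∀ i, φ.map _ (u n hk i) = a i) ∧
    c = L.cls ⟨φ.map _ (w n), φ.map_mem_cycles (w_mem_cycles n)⟩}

end Whitehead

/-!
A morphism `𝕃(U) → L` amounts to a *defining system*: an element `c = ∑_I c_I e_I` of degree `-1` of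
the convolution DGL `L ⊗ ℚ[e_1, …, e_k] / (e_i²)` with `c_∅ = 0` which satisfies the Maurer–Cartan
equation `∂c + ½[c, c] = 0` in all components below the top one, and the class of `φ(w)` is, up to
sign, the top component of `∂c + ½[c, c]`.

Gauge transformations change the cycles `c_{i}` within their homology classes and preserve the
obstruction, so the bracket set depends on the classes `x_i` only.  Along a quasi-isomorphism every
defining system lifts up to gauge equivalence, by obstruction theory over the subsets `I`.  So
bracket sets are invariants of the quasi-isomorphism type: for a formal `L` the homology `H` has
bracket sets in bijection with those of `L`, by a linear isomorphism.  Finally, if `k ≥ 3`, keeping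
only the components `c_{i}` of a defining system in `H` changes no component of `[c, c]` with two
indices, and these vanish because they lie below the top; so the Maurer–Cartan equation holds in
all components, with obstruction zero.
-/

universe w

/-! ### The convolution DGL -/

namespace GradedLie

/-- The bracket into degree `p`, extended by zero to degrees `m`, `n` with `m + n ≠ p`. -/
def bracketTo (G : GradedLie.{u}) (p : ℤ) {m n : ℤ} : G.obj m →ₗ[ℚ] G.obj n →ₗ[ℚ] G.obj p :=
  if h : m + n = p then G.bracket h else 0

variable {G : GradedLie.{u}}

theorem bracketTo_eq {m n p : ℤ} (h : m + n = p) (x : G.obj m) (y : G.obj n) :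
    G.bracketTo p x y = G.bracket h x y := by
  rw [bracketTo, dif_pos h]

theorem bracketTo_of_ne {m n p : ℤ} (h : m + n ≠ p) (x : G.obj m) (y : G.obj n) :
    G.bracketTo p x y = 0 := by
  rw [bracketTo, dif_neg h, LinearMap.zero_apply, LinearMap.zero_apply]

theorem bracketTo_antisymm {m n p : ℤ} (x : G.obj m) (y : G.obj n) :
    G.bracketTo p x y = -((-1 : ℚ) ^ (m * n) • G.bracketTo p y x) := by
  by_cases h : m + n = p
  · rw [bracketTo_eq h, bracketTo_eq ((add_comm n m).trans h)]
    exact G.antisymm h x y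
  · rw [bracketTo_of_ne h, bracketTo_of_ne fun h' => h ((add_comm m n).trans h'), smul_zero,
      neg_zero]

theorem bracketTo_bracketTo_left {l m n p q : ℤ} (h : l + m = q) (x : G.obj l) (y : G.obj m)
    (z : G.obj n) :
    G.bracketTo p (G.bracketTo q x y) z = G.bracketTo p (G.bracket rfl x y) z := by
  subst h
  rw [bracketTo_eq rfl]

theorem bracketTo_bracketTo_right {l m n p q : ℤ} (h : m + n = q) (x : G.obj l) (y : G.obj m)
    (z : G.obj n) :
    G.bracketTo p x (G.bracketTo q y z) = G.bracketTo p x (G.bracket rfl y z) := by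
  subst h
  rw [bracketTo_eq rfl]

theorem bracketTo_jacobi {l m n p : ℤ} (x : G.obj l) (y : G.obj m) (z : G.obj n) :
    G.bracketTo p x (G.bracket rfl y z) =
      G.bracketTo p (G.bracket rfl x y) z +
        (-1 : ℚ) ^ (l * m) • G.bracketTo p y (G.bracket rfl x z) := by
  by_cases h : l + m + n = p
  · rw [bracketTo_eq (by omega), bracketTo_eq h, bracketTo_eq (by omega)]
    exact G.jacobi _ _ _ _ _ _ x y z
  · rw [bracketTo_of_ne (by omega), bracketTo_of_ne h, bracketTo_of_ne (by omega), smul_zero,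
      add_zero]

end GradedLie

namespace Whitehead

open GradedLie

variable {k : ℕ}

theorem sum_powerset_sdiff {M : Type*} [AddCommMonoid M] (I : Finset (Fin k))
    (f : Finset (Fin k) → Finset (Fin k) → M) :
    ∑ J ∈ I.powerset, f (I \ J) J = ∑ J ∈ I.powerset, f J (I \ J) := by
  refine Finset.sum_nbij' (I \ ·) (I \ ·) ?_ ?_ ?_ ?_ ?_ <;> intro J hJ
  · exact Finset.mem_powerset.2 Finset.sdiff_subset
  · exact Finset.mem_powerset.2 Finset.sdiff_subset
  all_goals simp only [Finset.sdiff_sdiff_eq_self (Finset.mem_powerset.1 hJ)]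

theorem sum_triples_right {M : Type*} [AddCommMonoid M] (I : Finset (Fin k))
    (f : Finset (Fin k) → Finset (Fin k) → Finset (Fin k) → M) :
    ∑ A ∈ I.powerset, ∑ B ∈ (I \ A).powerset, f A B ((I \ A) \ B) =
      ∑ t ∈ triples I, f t.1 t.2.1 t.2.2 := by
  rw [sum_rotate I (fun A B C => f C A B), ← sum_triples I (fun A B C => f C A B)]
  exact (sum_powerset_sdiff I fun A J => ∑ B ∈ J.powerset, f A B (J \ B)).symm

theorem sum_triples_swap {M : Type*} [AddCommMonoid M] (I : Finset (Fin k))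
    (f : Finset (Fin k) → Finset (Fin k) → Finset (Fin k) → M) :
    ∑ t ∈ triples I, f t.2.1 t.1 t.2.2 = ∑ t ∈ triples I, f t.1 t.2.1 t.2.2 := by
  rw [← sum_triples I f, ← sum_triples I fun A B C => f B A C]
  exact Finset.sum_congr rfl fun J _ => sum_powerset_sdiff J fun A B => f A B (I \ J)

theorem mem_triples {I A B C : Finset (Fin k)} :
    (A, B, C) ∈ triples I ↔
      Disjoint A B ∧ Disjoint A C ∧ Disjoint B C ∧ A ∪ B ∪ C = I := by
  simp only [triples, Finset.mem_filter, Finset.mem_univ, true_and]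

theorem koszul_union_right (n : Fin k → ℤ) {A B C : Finset (Fin k)} (h : Disjoint B C) :
    koszul n A (B ∪ C) = koszul n A B * koszul n A C := by
  simp only [koszul, Finset.prod_union h, Finset.prod_mul_distrib]

/-- The total weight `∑_{i ∈ I} n_i`. -/
def weight (n : Fin k → ℤ) (I : Finset (Fin k)) : ℤ := ∑ i ∈ I, n i

theorem weight_sdiff (n : Fin k → ℤ) {I J : Finset (Fin k)} (h : J ⊆ I) :
    weight n J + weight n (I \ J) = weight n I := by
  have := Finset.sum_sdiff (f := n) h
  unfold weight
  omega

theorem neg_one_zpow_congr {a b : ℤ} (h : Even (a - b)) : (-1 : ℚ) ^ a = (-1) ^ b := by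
  rw [← sub_add_cancel a b, zpow_add₀ (by norm_num), h.neg_one_zpow, one_mul]

theorem weight_union (n : Fin k → ℤ) {I J : Finset (Fin k)} (h : Disjoint I J) :
    weight n (I ∪ J) = weight n I + weight n J :=
  Finset.sum_union h

/-- The sign with which `[x_J, y_K]` enters the bracket of `x` and `y` in the convolution algebra,
where `y` has degree `q`: besides the shuffle sign, `y` moves past the block `J`. -/
def convSign (n : Fin k → ℤ) (q : ℤ) (J K : Finset (Fin k)) : ℚ :=
  koszul n J K * (-1 : ℚ) ^ (q * weight n J)

variable {n : Fin k → ℤ}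

theorem koszul_comm {J K : Finset (Fin k)} (h : Disjoint J K) :
    koszul n K J = (-1 : ℚ) ^ (weight n J * weight n K) * koszul n J K := by
  rw [koszul_swap n h, gdeg, gdeg, sub_add_cancel, sub_add_cancel, weight, weight]

theorem convSign_swap {J K : Finset (Fin k)} (h : Disjoint J K) (p q : ℤ) :
    (-1 : ℚ) ^ (p * q) * convSign n p K J =
      (-1) ^ ((weight n J + p) * (weight n K + q)) * convSign n q J K := by
  have key : (-1 : ℚ) ^ (p * q + weight n J * weight n K + p * weight n K) =
      (-1) ^ ((weight n J + p) * (weight n K + q) + q * weight n J) :=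
    neg_one_zpow_congr ⟨-(q * weight n J), by ring⟩
  simp only [zpow_add₀ (by norm_num : (-1 : ℚ) ≠ 0)] at key
  rw [convSign, convSign, koszul_comm h]
  linear_combination koszul n J K * key

theorem convSign_assoc {A B C : Finset (Fin k)} (hAB : Disjoint A B) (hBC : Disjoint B C)
    (q r : ℤ) :
    convSign n (q + r) A (B ∪ C) * convSign n r B C =
      convSign n r (A ∪ B) C * convSign n q A B := by
  have key : (-1 : ℚ) ^ ((q + r) * weight n A + r * weight n B) =
      (-1) ^ (r * weight n (A ∪ B) + q * weight n A) := by
    rw [weight_union n hAB]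
    ring_nf
  simp only [zpow_add₀ (by norm_num : (-1 : ℚ) ≠ 0)] at key
  simp only [convSign, koszul_union_right n hBC, koszul_union n hAB]
  linear_combination koszul n A B * koszul n A C * koszul n B C * key

theorem convSign_left_comm {A B C : Finset (Fin k)} (hAB : Disjoint A B) (hAC : Disjoint A C)
    (hBC : Disjoint B C) (p q r : ℤ) :
    (-1 : ℚ) ^ (p * q) * (convSign n (p + r) B (A ∪ C) * convSign n r A C) =
      (-1) ^ ((weight n A + p) * (weight n B + q)) *
        (convSign n (q + r) A (B ∪ C) * convSign n r B C) := by
  have key : (-1 : ℚ) ^ (p * q + (p + r) * weight n B + r * weight n A +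
        weight n A * weight n B) =
      (-1) ^ ((weight n A + p) * (weight n B + q) + (q + r) * weight n A + r * weight n B) :=
    neg_one_zpow_congr ⟨-(q * weight n A), by ring⟩
  simp only [zpow_add₀ (by norm_num : (-1 : ℚ) ≠ 0)] at key
  simp only [convSign, koszul_union_right n hBC, koszul_union_right n hAC, koszul_comm hAB]
  linear_combination koszul n A B * koszul n A C * koszul n B C * key

variable (n) in
/-- The bracket of the convolution algebra `G ⊗ ℚ[e_1, …, e_k] / (e_i²)`, for families of
coefficients `x_I` of `e_I`. -/
def convBracket (G : GradedLie.{u}) {p q r : ℤ} :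
    (∀ I, G.obj (weight n I + p)) →ₗ[ℚ] (∀ I, G.obj (weight n I + q)) →ₗ[ℚ]
      (∀ I, G.obj (weight n I + r)) :=
  LinearMap.mk₂ ℚ
    (fun x y I => ∑ J ∈ I.powerset, convSign n q J (I \ J) • G.bracketTo _ (x J) (y (I \ J)))
    (fun x x' y => by
      ext I; simp only [Pi.add_apply, map_add, LinearMap.add_apply, smul_add,
        Finset.sum_add_distrib])
    (fun c x y => by
      ext I; simp only [Pi.smul_apply, map_smul, LinearMap.smul_apply, Finset.smul_sum,
        smul_comm c])
    (fun x y y' => by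
      ext I; simp only [Pi.add_apply, map_add, smul_add, Finset.sum_add_distrib])
    (fun c x y => by
      ext I; simp only [Pi.smul_apply, map_smul, Finset.smul_sum, smul_comm c])

variable {G : GradedLie.{u}}

theorem convBracket_apply {p q r : ℤ} (x : ∀ I, G.obj (weight n I + p))
    (y : ∀ I, G.obj (weight n I + q)) (I : Finset (Fin k)) :
    (convBracket n G x y : ∀ I, G.obj (weight n I + r)) I =
      ∑ J ∈ I.powerset, convSign n q J (I \ J) • G.bracketTo _ (x J) (y (I \ J)) :=
  rfl

theorem convBracket_antisymm {p q r : ℤ} (x : ∀ I, G.obj (weight n I + p))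
    (y : ∀ I, G.obj (weight n I + q)) :
    (convBracket n G x y : ∀ I, G.obj (weight n I + r)) =
      -((-1 : ℚ) ^ (p * q) • convBracket n G y x) := by
  ext I
  rw [Pi.neg_apply, Pi.smul_apply, convBracket_apply, convBracket_apply, Finset.smul_sum,
    ← Finset.sum_neg_distrib,
    ← sum_powerset_sdiff I fun K J =>
      -((-1 : ℚ) ^ (p * q) • convSign n p K J • G.bracketTo _ (y K) (x J))]
  refine Finset.sum_congr rfl fun J _ => ?_
  rw [bracketTo_antisymm, smul_neg, smul_smul, smul_smul,
    convSign_swap Finset.disjoint_sdiff, mul_comm]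

theorem convBracket_convBracket_right {l m r mr p : ℤ} (h : m + r = mr)
    (x : ∀ I, G.obj (weight n I + l)) (y : ∀ I, G.obj (weight n I + m))
    (z : ∀ I, G.obj (weight n I + r)) (I : Finset (Fin k)) :
    (convBracket n G x (convBracket n G y z : ∀ I, G.obj (weight n I + mr)) :
        ∀ I, G.obj (weight n I + p)) I =
      ∑ t ∈ triples I, (convSign n mr t.1 (t.2.1 ∪ t.2.2) * convSign n r t.2.1 t.2.2) •
        G.bracketTo _ (x t.1) (G.bracket rfl (y t.2.1) (z t.2.2)) := by
  rw [← sum_triples_right I fun A B C => (convSign n mr A (B ∪ C) * convSign n r B C) •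
        G.bracketTo _ (x A) (G.bracket rfl (y B) (z C)), convBracket_apply]
  refine Finset.sum_congr rfl fun A _ => ?_
  rw [convBracket_apply, map_sum, Finset.smul_sum]
  refine Finset.sum_congr rfl fun B hB => ?_
  have hB := Finset.mem_powerset.1 hB
  rw [map_smul, smul_smul, Finset.union_sdiff_of_subset hB, bracketTo_bracketTo_right]
  have := weight_sdiff n hB
  omega

theorem convBracket_convBracket_left {l m r lm p : ℤ} (h : l + m = lm)
    (x : ∀ I, G.obj (weight n I + l)) (y : ∀ I, G.obj (weight n I + m))
    (z : ∀ I, G.obj (weight n I + r)) (I : Finset (Fin k)) :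
    (convBracket n G (convBracket n G x y : ∀ I, G.obj (weight n I + lm)) z :
        ∀ I, G.obj (weight n I + p)) I =
      ∑ t ∈ triples I, (convSign n r (t.1 ∪ t.2.1) t.2.2 * convSign n m t.1 t.2.1) •
        G.bracketTo _ (G.bracket rfl (x t.1) (y t.2.1)) (z t.2.2) := by
  rw [← sum_triples I fun A B C => (convSign n r (A ∪ B) C * convSign n m A B) •
        G.bracketTo _ (G.bracket rfl (x A) (y B)) (z C), convBracket_apply]
  refine Finset.sum_congr rfl fun J _ => ?_
  rw [convBracket_apply, map_sum, LinearMap.sum_apply, Finset.smul_sum]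
  refine Finset.sum_congr rfl fun A hA => ?_
  have hA := Finset.mem_powerset.1 hA
  rw [map_smul, LinearMap.smul_apply, smul_smul, Finset.union_sdiff_of_subset hA,
    bracketTo_bracketTo_left]
  have := weight_sdiff n hA
  omega

theorem convBracket_jacobi {l m r lm mr lr p : ℤ} (hlm : l + m = lm) (hmr : m + r = mr)
    (hlr : l + r = lr) (x : ∀ I, G.obj (weight n I + l)) (y : ∀ I, G.obj (weight n I + m))
    (z : ∀ I, G.obj (weight n I + r)) :
    (convBracket n G x (convBracket n G y z : ∀ I, G.obj (weight n I + mr)) :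
        ∀ I, G.obj (weight n I + p)) =
      convBracket n G (convBracket n G x y : ∀ I, G.obj (weight n I + lm)) z +
        (-1 : ℚ) ^ (l * m) •
          convBracket n G y (convBracket n G x z : ∀ I, G.obj (weight n I + lr)) := by
  ext I
  rw [Pi.add_apply, Pi.smul_apply, convBracket_convBracket_right hmr,
    convBracket_convBracket_left hlm, convBracket_convBracket_right hlr,
    ← sum_triples_swap I fun B A C => (convSign n lr B (A ∪ C) * convSign n r A C) •
        G.bracketTo _ (y B) (G.bracket rfl (x A) (z C)),
    Finset.smul_sum, ← Finset.sum_add_distrib]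
  refine Finset.sum_congr rfl fun ⟨A, B, C⟩ ht => ?_
  obtain ⟨hAB, hAC, hBC, -⟩ := mem_triples.1 ht
  subst hmr hlr
  rw [smul_smul, convSign_left_comm hAB hAC hBC, ← convSign_assoc hAB hBC, bracketTo_jacobi,
    smul_add, smul_smul, mul_comm (_ ^ _)]

end Whitehead

namespace DGL

section Curvature

variable {L : DGL.{u}}

theorem bracket_comm_neg_one (x y : L.obj (-1)) :
    L.bracket (show (-1 : ℤ) + -1 = -2 by norm_num) x y = L.bracket (by norm_num) y x := by
  rw [L.antisymm]
  norm_num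

/-- The curvature `∂c + ½[c, c]` of an element of degree `-1`; Maurer–Cartan elements are those of
curvature zero. -/
def curvature (c : L.obj (-1)) : L.obj (-2) :=
  L.d (-1) (-2) (by norm_num) c + (1 / 2 : ℚ) • L.bracket (by norm_num) c c

theorem bracket_bracket_self (c : L.obj (-1)) :
    L.bracket (show (-2 : ℤ) + -1 = -3 by norm_num) (L.bracket (by norm_num) c c) c = 0 := by
  have hj := L.jacobi (lm := -2) (mn := -2) (ln := -2) (p := -3) (by norm_num) (by norm_num)
    (by norm_num) (by norm_num) (by norm_num) (by norm_num) c c c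
  rw [L.antisymm _ c (L.bracket _ c c)] at hj
  norm_num at hj
  linear_combination (norm := module) (-(1 / 3) : ℚ) • hj

theorem d_curvature (c : L.obj (-1)) :
    L.d (-2) (-3) (by norm_num) (curvature c) = L.bracket (by norm_num) (curvature c) c := by
  have hs := L.antisymm (show (-1 : ℤ) + -2 = -3 by norm_num) c (L.d (-1) (-2) (by norm_num) c)
  norm_num at hs
  rw [curvature, map_add, map_smul, L.d_d, L.leibniz (m' := -2) (n' := -2) _ (by norm_num)
    (by norm_num) (by norm_num) (by norm_num) (by norm_num), map_add, map_smul,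
    LinearMap.add_apply, LinearMap.smul_apply, bracket_bracket_self, hs]
  norm_num
  module

/-- The infinitesimal gauge action `c ↦ c + ∂h - [h, c]` of an element `h` of degree `0`. -/
def gauge (h : L.obj 0) (c : L.obj (-1)) : L.obj (-1) :=
  c + (L.d 0 (-1) (by norm_num) h - L.bracket (by norm_num) h c)

theorem curvature_add (c e : L.obj (-1)) :
    curvature (c + e) = curvature c +
      (L.d (-1) (-2) (by norm_num) e + L.bracket (by norm_num) e c) +
      (1 / 2 : ℚ) • L.bracket (by norm_num) e e := by
  simp only [curvature, map_add, LinearMap.add_apply]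
  rw [bracket_comm_neg_one c e]
  module

theorem curvature_gauge (h : L.obj 0) (c : L.obj (-1)) :
    curvature (gauge h c) = curvature c - L.bracket (by norm_num) h (curvature c) +
      (1 / 2 : ℚ) • L.bracket (by norm_num) (gauge h c - c) (gauge h c - c) := by
  have hj := L.jacobi (lm := -1) (mn := -2) (ln := -1) (p := -2) (by norm_num) (by norm_num)
    (by norm_num) (by norm_num) (by norm_num) (by norm_num) h c c
  rw [bracket_comm_neg_one c (L.bracket _ h c)] at hj
  have key : L.d (-1) (-2) (by norm_num) (gauge h c - c) +
      L.bracket (by norm_num) (gauge h c - c) c = -L.bracket (by norm_num) h (curvature c) := by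
    simp only [gauge, add_sub_cancel_left, curvature, map_sub, map_add, map_smul,
      LinearMap.sub_apply, L.d_d]
    rw [L.leibniz (m' := -1) (n' := -2) _ (by norm_num) (by norm_num) (by norm_num) (by norm_num)
      (by norm_num), hj]
    norm_num
    module
  have hadd := curvature_add c (gauge h c - c)
  rwa [add_sub_cancel, key, ← sub_eq_add_neg] at hadd

theorem Hom.map_curvature {B : DGL.{v}} (f : Hom L B) (c : L.obj (-1)) :
    f.map _ (curvature c) = curvature (f.map _ c) := by
  rw [curvature, map_add, map_smul, f.map_d, f.map_bracket, curvature]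

end Curvature

end DGL

namespace Whitehead

open GradedLie DGL

variable {k : ℕ} (n : Fin k → ℤ)

/-- The componentwise differential of the convolution algebra. -/
def convD (L : DGL.{u}) (p q : ℤ) (h : q + 1 = p) :
    (∀ I, L.obj (weight n I + p)) →ₗ[ℚ] ∀ I, L.obj (weight n I + q) :=
  LinearMap.pi fun I => L.d _ _ (by omega) ∘ₗ LinearMap.proj I

variable {n} in
theorem convD_convBracket {L : DGL.{u}} {p q r p' q' r' : ℤ} (h : p + q = r) (hp : p' + 1 = p)
    (hq : q' + 1 = q) (hr : r' + 1 = r) (x : ∀ I, L.obj (weight n I + p))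
    (y : ∀ I, L.obj (weight n I + q)) :
    convD n L r r' hr (convBracket n L.toGradedLie x y) =
      convBracket n L.toGradedLie (convD n L p p' hp x) y +
        (-1 : ℚ) ^ p • convBracket n L.toGradedLie x (convD n L q q' hq y) := by
  ext I
  change L.d _ _ _ (convBracket n _ x y I) = convBracket n _ _ y I + (-1 : ℚ) ^ p •
    (convBracket n L.toGradedLie x (convD n L q q' hq y) : ∀ I, L.obj (weight n I + r')) I
  rw [convBracket_apply, convBracket_apply, convBracket_apply, map_sum, Finset.smul_sum,
    ← Finset.sum_add_distrib]
  refine Finset.sum_congr rfl fun J hJ => ?_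
  have hJ := weight_sdiff n (Finset.mem_powerset.1 hJ)
  have hs : convSign n q J (I \ J) * (-1 : ℚ) ^ (weight n J + p) =
      (-1) ^ p * convSign n q' J (I \ J) := by
    have key : (-1 : ℚ) ^ (q * weight n J + (weight n J + p)) = (-1) ^ (p + q' * weight n J) :=
      neg_one_zpow_congr ⟨weight n J, by rw [← hq]; ring⟩
    simp only [zpow_add₀ (by norm_num : (-1 : ℚ) ≠ 0)] at key ⊢
    rw [convSign, convSign]
    linear_combination koszul n J (I \ J) * key
  rw [map_smul, bracketTo_eq (by omega), L.leibniz (m' := weight n J + p')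
    (n' := weight n (I \ J) + q') _ (by omega) (by omega) (by omega) (by omega) (by omega),
    bracketTo_eq (by omega), bracketTo_eq (by omega), smul_add, smul_smul, smul_smul, hs]
  rfl

/-- The convolution DGL `L ⊗ ℚ[e_1, …, e_k] / (e_i²)`, with `e_i` of degree `-n_i`.  Its element
`∑_I x_I e_I` of degree `p` is the family of the `x_I`, of degree `∑_{i ∈ I} n_i + p`. -/
def conv (L : DGL.{u}) : DGL.{u} where
  obj p := ∀ I, L.obj (weight n I + p)
  bracket _ := convBracket n L.toGradedLie
  antisymm _ := convBracket_antisymm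
  jacobi hlm hmr hlr _ _ _ := convBracket_jacobi hlm hmr hlr
  d := convD n L
  d_d _ _ x := funext fun I => L.d_d _ _ (x I)
  leibniz h hp hq hr _ _ := convD_convBracket h hp hq hr

variable {n} in
theorem map_convBracket {A : GradedLie.{u}} {B : GradedLie.{v}} (g : ∀ p, A.obj p →ₗ[ℚ] B.obj p)
    (hg : ∀ {p q r : ℤ} (h : p + q = r) (x : A.obj p) (y : A.obj q),
      g r (A.bracket h x y) = B.bracket h (g p x) (g q y))
    {p q r : ℤ} (x : ∀ I, A.obj (weight n I + p)) (y : ∀ I, A.obj (weight n I + q))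
    (I : Finset (Fin k)) :
    g _ ((convBracket n A x y : ∀ I, A.obj (weight n I + r)) I) =
      convBracket n B (fun J => g _ (x J)) (fun J => g _ (y J)) I := by
  rw [convBracket_apply, convBracket_apply, map_sum]
  refine Finset.sum_congr rfl fun J _ => ?_
  rw [map_smul]
  by_cases h : weight n J + p + (weight n (I \ J) + q) = weight n I + r
  · rw [bracketTo_eq h, bracketTo_eq h, hg]
  · rw [bracketTo_of_ne h, bracketTo_of_ne h, map_zero]

/-- The morphism of convolution DGLs which applies `f` to the components. -/
def convMap {A : DGL.{u}} {B : DGL.{v}} (f : Hom A B) : Hom (conv n A) (conv n B) where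
  map _ := LinearMap.pi fun I => f.map _ ∘ₗ LinearMap.proj I
  map_bracket _ x y := funext (map_convBracket f.map f.map_bracket x y)
  map_d _ x := funext fun I => f.map_d _ (x I)

end Whitehead

/-- Transport along an equality of degrees. -/
abbrev GradedLie.cast (G : GradedLie.{u}) {p q : ℤ} (h : p = q) : G.obj p ≃ₗ[ℚ] G.obj q :=
  LinearEquiv.cast h

namespace DGL

theorem d_cast (L : DGL.{u}) {p q p' q' : ℤ} (hp : p = p') (h : q + 1 = p) (hq : q = q')
    (h' : q' + 1 = p') (x : L.obj p) :
    L.d p' q' h' (L.cast hp x) = L.cast hq (L.d p q h x) := by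
  subst hp hq
  rfl

theorem Hom.map_cast {A : DGL.{u}} {B : DGL.{v}} (f : Hom A B) {p q : ℤ} (h : p = q)
    (x : A.obj p) : f.map q (A.cast h x) = B.cast h (f.map p x) := by
  subst h
  rfl

theorem cls_eq_cls {L : DGL.{u}} {p : ℤ} (q : ℤ) (h : p + 1 = q) {x y : L.cycles p} :
    L.cls x = L.cls y ↔ ∃ z, L.d q p h z = x.1 - y.1 := by
  rw [← sub_eq_zero, ← map_sub, cls_eq_zero, mem_boundaries q h]
  rfl

end DGL

namespace Whitehead

open GradedLie DGL

variable {k : ℕ} {n : Fin k → ℤ} {L : DGL.{u}}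

theorem weight_singleton (n : Fin k → ℤ) (i : Fin k) : weight n {i} = n i :=
  Finset.sum_singleton n i

section Coefficients

variable {p q r : ℤ}

/-- The coefficient `x_I` of an element `∑_I x_I e_I` of the convolution DGL. -/
def coeff (I : Finset (Fin k)) : (conv n L).obj p →ₗ[ℚ] L.obj (weight n I + p) :=
  LinearMap.proj I

/-- The element `∑_I x_I e_I` of the convolution DGL. -/
def ofCoeff (x : ∀ I, L.obj (weight n I + p)) : (conv n L).obj p := x

theorem coeff_ofCoeff (x : ∀ I, L.obj (weight n I + p)) (I : Finset (Fin k)) :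
    coeff I (ofCoeff x) = x I :=
  rfl

theorem conv_ext {x y : (conv n L).obj p} (h : ∀ I, coeff I x = coeff I y) : x = y :=
  funext h

theorem coeff_d (h : q + 1 = p) (x : (conv n L).obj p) (I : Finset (Fin k)) :
    coeff I ((conv n L).d p q h x) = L.d _ _ (by omega) (coeff I x) :=
  rfl

theorem coeff_convMap {A : DGL.{u}} {B : DGL.{v}} (f : Hom A B) (x : (conv n A).obj p)
    (I : Finset (Fin k)) : coeff I ((convMap n f).map p x) = f.map _ (coeff I x) :=
  rfl

theorem coeff_bracket (h : p + q = r) (x : (conv n L).obj p) (y : (conv n L).obj q)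
    (I : Finset (Fin k)) :
    coeff I ((conv n L).bracket h x y) =
      ∑ J ∈ I.powerset, convSign n q J (I \ J) • L.bracketTo _ (coeff J x) (coeff (I \ J) y) :=
  rfl

theorem coeff_bracket_eq_zero (h : p + q = r) {x : (conv n L).obj p} {y : (conv n L).obj q}
    {I : Finset (Fin k)} (hxy : ∀ J ⊆ I, coeff J x = 0 ∨ coeff (I \ J) y = 0) :
    coeff I ((conv n L).bracket h x y) = 0 := by
  rw [coeff_bracket]
  refine Finset.sum_eq_zero fun J hJ => ?_
  rcases hxy J (Finset.mem_powerset.1 hJ) with h | h <;>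
    simp only [h, map_zero, LinearMap.zero_apply, smul_zero]

theorem coeff_bracket_self_congr (h : p + p = r) {x y : (conv n L).obj p}
    (hx : coeff ∅ x = 0) (hy : coeff ∅ y = 0) {I : Finset (Fin k)}
    (hxy : ∀ J ⊂ I, coeff J x = coeff J y) :
    coeff I ((conv n L).bracket h x x) = coeff I ((conv n L).bracket h y y) := by
  rw [coeff_bracket, coeff_bracket]
  refine Finset.sum_congr rfl fun J hJ => ?_
  obtain rfl | hJI := eq_or_ne J I
  · rw [show J \ J = ∅ from sdiff_self, hx, hy, map_zero, map_zero]
  obtain rfl | hJ₀ := J.eq_empty_or_nonempty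
  · simp only [hx, hy, map_zero, LinearMap.zero_apply]
  · have hJ := Finset.mem_powerset.1 hJ
    rw [hxy J (hJ.ssubset_of_ne hJI), hxy _ (Finset.sdiff_ssubset hJ hJ₀)]

theorem coeff_curvature (c : (conv n L).obj (-1)) (I : Finset (Fin k)) :
    coeff I (curvature c) = L.d _ _ (by omega) (coeff I c) +
      (1 / 2 : ℚ) • coeff I ((conv n L).bracket (by norm_num) c c) :=
  rfl

theorem coeff_gauge (h : (conv n L).obj 0) (c : (conv n L).obj (-1)) (I : Finset (Fin k)) :
    coeff I (gauge h c) = coeff I c + (L.d _ _ (by omega) (coeff I h) -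
      coeff I ((conv n L).bracket (by norm_num) h c)) :=
  rfl

theorem coeff_singleton_curvature {c : (conv n L).obj (-1)} (hc : coeff ∅ c = 0) (i : Fin k) :
    coeff {i} (curvature c) = L.d _ _ (by omega) (coeff {i} c) := by
  rw [coeff_curvature, coeff_bracket_eq_zero _ fun J hJ => ?_, smul_zero, add_zero]
  obtain rfl | rfl := Finset.subset_singleton_iff.1 hJ
  · exact .inl hc
  · exact .inr (by rw [show ({i} : Finset (Fin k)) \ {i} = ∅ from sdiff_self]; exact hc)

theorem coeff_curvature_congr {c c' : (conv n L).obj (-1)} (hc : coeff ∅ c = 0)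
    (hc' : coeff ∅ c' = 0) {I : Finset (Fin k)} (h : ∀ J ⊆ I, coeff J c = coeff J c') :
    coeff I (curvature c) = coeff I (curvature c') := by
  rw [coeff_curvature, coeff_curvature, h I subset_rfl,
    coeff_bracket_self_congr _ hc hc' fun J hJ => h J hJ.subset]

theorem coeff_empty_curvature {c : (conv n L).obj (-1)} (hc : coeff ∅ c = 0) :
    coeff ∅ (curvature c) = 0 := by
  rw [coeff_curvature, hc, map_zero, zero_add, coeff_bracket_eq_zero _ fun J hJ => .inl ?_,
    smul_zero]
  rw [Finset.subset_empty.1 hJ, hc]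

theorem coeff_bracket_self_mem_cycles {c : (conv n L).obj (-1)}
    (hc : coeff ∅ c = 0) {I : Finset (Fin k)} (hI : ∀ J ⊂ I, coeff J (curvature c) = 0) :
    coeff I ((conv n L).bracket (show (-1 : ℤ) + -1 = -2 by norm_num) c c) ∈ L.cycles _ := by
  have hd : coeff I ((conv n L).d (-2) (-3) (by norm_num) (curvature c)) = 0 := by
    rw [d_curvature]
    refine coeff_bracket_eq_zero _ fun J hJ => ?_
    obtain rfl | hJI := eq_or_ne J I
    · exact .inr (by rw [show J \ J = ∅ from sdiff_self]; exact hc)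
    · exact .inl (hI J (hJ.ssubset_of_ne hJI))
  rw [mem_cycles (weight n I + -3) (by omega), ← coeff_d (show (-3 : ℤ) + 1 = -2 by norm_num)]
  rw [curvature, map_add, d_d, zero_add, map_smul, map_smul] at hd
  exact (smul_eq_zero.1 hd).resolve_left (by norm_num)

end Coefficients

/-! ### Defining systems and gauge transformations -/

/-- A defining system for a higher Whitehead bracket: an element of degree `-1` of the convolution
DGL without constant term which satisfies the Maurer–Cartan equation in every component but the
top one. -/
structure IsDefiningSystem (c : (conv n L).obj (-1)) : Prop where
  coeff_empty : coeff ∅ c = 0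
  coeff_curvature : ∀ I ≠ Finset.univ, coeff I (curvature c) = 0

theorem weight_univ_sub_two (n : Fin k → ℤ) :
    weight n Finset.univ + -2 = (∑ i, n i) - 2 :=
  rfl

namespace IsDefiningSystem

variable {c c' : (conv n L).obj (-1)}

theorem d_coeff_univ_curvature (hc : IsDefiningSystem c) :
    L.d _ (weight n Finset.univ + -3) (by omega) (coeff Finset.univ (curvature c)) = 0 := by
  rw [← coeff_d (show (-3 : ℤ) + 1 = -2 by norm_num), d_curvature]
  refine coeff_bracket_eq_zero _ fun J _ => ?_
  obtain rfl | hJ := eq_or_ne J Finset.univ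
  · exact .inr (by rw [sdiff_self]; exact hc.coeff_empty)
  · exact .inl (hc.coeff_curvature J hJ)

/-- The top component of the curvature, with the sign for which the universal defining system
yields `w`. -/
def topCycle (hc : IsDefiningSystem c) : L.cycles ((∑ i, n i) - 2) :=
  ⟨-L.cast (weight_univ_sub_two n) (coeff Finset.univ (curvature c)), by
    rw [mem_cycles (weight n Finset.univ + -3) (by unfold weight; omega), map_neg,
      L.d_cast (q := weight n Finset.univ + -3) _ (by omega) rfl, hc.d_coeff_univ_curvature,
      map_zero, neg_zero]⟩

theorem coe_topCycle (hc : IsDefiningSystem c) :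
    hc.topCycle.1 = -L.cast (weight_univ_sub_two n) (coeff Finset.univ (curvature c)) :=
  rfl

/-- The homology class obstructing the Maurer–Cartan equation in the top component. -/
def obstruction (hc : IsDefiningSystem c) : L.H ((∑ i, n i) - 2) := L.cls hc.topCycle

theorem obstruction_congr (hc : IsDefiningSystem c) (hc' : IsDefiningSystem c')
    (h : ∀ I ≠ Finset.univ, coeff I c = coeff I c') : hc.obstruction = hc'.obstruction := by
  have hw : weight n Finset.univ + -1 = (∑ i, n i) - 1 := rfl
  refine (cls_eq_cls ((∑ i, n i) - 1) (by omega)).2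
    ⟨L.cast hw (coeff Finset.univ c' - coeff Finset.univ c), ?_⟩
  rw [L.d_cast hw (by omega) (weight_univ_sub_two n), coe_topCycle, coe_topCycle,
    Whitehead.coeff_curvature, Whitehead.coeff_curvature,
    coeff_bracket_self_congr _ hc.coeff_empty hc'.coeff_empty fun J hJ => h J hJ.ne]
  simp only [map_sub, map_add]
  abel

/-- The cycle `c_{i}`, in degree `n_i - 1`. -/
def leaf (hc : IsDefiningSystem c) (hk : 2 ≤ k) (i : Fin k) : L.cycles (n i - 1) :=
  ⟨L.cast (by rw [weight_singleton]; rfl) (coeff {i} c), by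
    have hd := hc.coeff_curvature {i} (single hk i).2.2
    rw [coeff_singleton_curvature hc.coeff_empty] at hd
    rw [mem_cycles (n i - 2) (by omega), L.d_cast (q := weight n {i} + -2) _ (by omega)
      (by rw [weight_singleton]; rfl), hd, map_zero]⟩

theorem convMap {A : DGL.{u}} {B : DGL.{v}} {c : (conv n A).obj (-1)} (hc : IsDefiningSystem c)
    (f : Hom A B) : IsDefiningSystem ((convMap n f).map _ c) where
  coeff_empty := by rw [coeff_convMap, hc.coeff_empty, map_zero]
  coeff_curvature I hI := by
    rw [← Hom.map_curvature, coeff_convMap, hc.coeff_curvature I hI, map_zero]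

theorem obstruction_convMap {A : DGL.{u}} {B : DGL.{v}} {c : (conv n A).obj (-1)}
    (hc : IsDefiningSystem c) (f : Hom A B) :
    (hc.convMap f).obstruction = f.mapH _ hc.obstruction := by
  refine congrArg B.cls (Subtype.ext ?_)
  change (hc.convMap f).topCycle.1 = f.map _ hc.topCycle.1
  rw [coe_topCycle, coe_topCycle, ← Hom.map_curvature, coeff_convMap, map_neg, Hom.map_cast]

theorem leaf_convMap {A : DGL.{u}} {B : DGL.{v}} {c : (conv n A).obj (-1)}
    (hc : IsDefiningSystem c) (f : Hom A B) (hk : 2 ≤ k) (i : Fin k) :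
    ((hc.convMap f).leaf hk i).1 = f.map _ (hc.leaf hk i).1 :=
  (f.map_cast _ (coeff {i} c)).symm

end IsDefiningSystem

section Gauge

variable {c c' : (conv n L).obj (-1)}

/-- The element `h e_I` of the convolution DGL. -/
def monomial {p : ℤ} (I : Finset (Fin k)) (h : L.obj (weight n I + p)) : (conv n L).obj p :=
  ofCoeff (Pi.single I h)

theorem coeff_monomial_self {p : ℤ} {I : Finset (Fin k)} (h : L.obj (weight n I + p)) :
    coeff I (monomial I h) = h := by
  rw [monomial, coeff_ofCoeff, Pi.single_eq_same]

theorem coeff_monomial_of_ne {p : ℤ} {I : Finset (Fin k)} (h : L.obj (weight n I + p))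
    {J : Finset (Fin k)} (hJ : J ≠ I) : coeff J (monomial I h) = 0 := by
  rw [monomial, coeff_ofCoeff, Pi.single_eq_of_ne hJ]

variable {I : Finset (Fin k)} (h : L.obj (weight n I + 0))

theorem coeff_gauge_monomial_of_not_subset {K : Finset (Fin k)} (hK : ¬ I ⊆ K) :
    coeff K (gauge (monomial I h) c) = coeff K c := by
  have hne {J : Finset (Fin k)} (hJ : J ⊆ K) : J ≠ I := fun e => hK (e ▸ hJ)
  rw [coeff_gauge, coeff_monomial_of_ne h (hne subset_rfl), map_zero,
    coeff_bracket_eq_zero _ fun J hJ => .inl (coeff_monomial_of_ne h (hne hJ)), sub_zero, add_zero]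

theorem coeff_gauge_monomial_self (hc : coeff ∅ c = 0) :
    coeff I (gauge (monomial I h) c) = coeff I c + L.d _ _ (by omega) h := by
  rw [coeff_gauge, coeff_monomial_self, coeff_bracket_eq_zero _ fun J _ => ?_, sub_zero]
  obtain rfl | hJ := eq_or_ne J I
  · exact .inr (by rw [show J \ J = ∅ from sdiff_self]; exact hc)
  · exact .inl (coeff_monomial_of_ne h hJ)

theorem curvature_gauge_monomial (hc : IsDefiningSystem c) (hI : I.Nonempty) :
    curvature (gauge (monomial I h) c) = curvature c := by
  obtain ⟨i, hi⟩ := hI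
  have hF : (conv n L).bracket (show (0 : ℤ) + -2 = -2 by norm_num) (monomial I h)
      (curvature c) = 0 := by
    refine conv_ext fun K => (coeff_bracket_eq_zero _ fun J _ => ?_).trans (map_zero _).symm
    obtain rfl | hJ := eq_or_ne J I
    · refine .inr (hc.coeff_curvature _ fun e => ?_)
      exact (Finset.mem_sdiff.1 (e ▸ Finset.mem_univ i)).2 hi
    · exact .inl (coeff_monomial_of_ne h hJ)
  have hδ : (conv n L).bracket (show (-1 : ℤ) + -1 = -2 by norm_num) (gauge (monomial I h) c - c)
      (gauge (monomial I h) c - c) = 0 := by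
    have hsub {J : Finset (Fin k)} (hJ : ¬ I ⊆ J) : coeff J (gauge (monomial I h) c - c) = 0 := by
      rw [map_sub, coeff_gauge_monomial_of_not_subset h hJ, sub_self]
    refine conv_ext fun K => (coeff_bracket_eq_zero _ fun J _ => ?_).trans (map_zero _).symm
    by_cases hJ : I ⊆ J
    · exact .inr (hsub fun hIK => (Finset.mem_sdiff.1 (hIK hi)).2 (hJ hi))
    · exact .inl (hsub hJ)
  rw [curvature_gauge, hF, hδ, sub_zero, smul_zero, add_zero]

/-- Gauge equivalence: `c'` arises from `c` by infinitesimal gauge transformations along elements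
`h e_I` with `I ≠ ∅`; as `e_I² = 0`, each of these is the full gauge transformation. -/
def GaugeEquiv : (conv n L).obj (-1) → (conv n L).obj (-1) → Prop :=
  Relation.ReflTransGen fun c c' =>
    ∃ (I : Finset (Fin k)) (h : L.obj (weight n I + 0)), I.Nonempty ∧ c' = gauge (monomial I h) c

namespace GaugeEquiv

theorem isDefiningSystem_and_curvature_eq (hcc' : GaugeEquiv c c') (hc : IsDefiningSystem c) :
    IsDefiningSystem c' ∧ curvature c' = curvature c := by
  induction hcc' with
  | refl => exact ⟨hc, rfl⟩
  | tail _ hstep ih =>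
    obtain ⟨I, h, hI, rfl⟩ := hstep
    obtain ⟨hb, hF⟩ := ih
    have hcurv := (curvature_gauge_monomial h hb hI).trans hF
    refine ⟨⟨?_, fun J hJ => by rw [hcurv]; exact hc.coeff_curvature J hJ⟩, hcurv⟩
    rw [coeff_gauge_monomial_of_not_subset h fun e => hI.ne_empty (Finset.subset_empty.1 e)]
    exact hb.coeff_empty

theorem isDefiningSystem (hcc' : GaugeEquiv c c') (hc : IsDefiningSystem c) :
    IsDefiningSystem c' :=
  (hcc'.isDefiningSystem_and_curvature_eq hc).1

theorem obstruction_eq (hcc' : GaugeEquiv c c') (hc : IsDefiningSystem c) :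
    (hcc'.isDefiningSystem hc).obstruction = hc.obstruction := by
  refine congrArg L.cls (Subtype.ext ?_)
  rw [IsDefiningSystem.coe_topCycle, IsDefiningSystem.coe_topCycle,
    (hcc'.isDefiningSystem_and_curvature_eq hc).2]

theorem exists_d_eq (hcc' : GaugeEquiv c c') (hc : IsDefiningSystem c) (i : Fin k) :
    ∃ z, L.d (weight n {i} + 0) _ (by omega) z = coeff {i} c' - coeff {i} c := by
  induction hcc' with
  | refl => exact ⟨0, by rw [map_zero, sub_self]⟩
  | @tail b _ hb hstep ih =>
    obtain ⟨I, h, hI, rfl⟩ := hstep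
    obtain ⟨z, hz⟩ := ih
    by_cases hIi : I ⊆ {i}
    · obtain rfl := (Finset.subset_singleton_iff.1 hIi).resolve_left hI.ne_empty
      refine ⟨z + h, ?_⟩
      rw [coeff_gauge_monomial_self h (isDefiningSystem hb hc).coeff_empty, map_add, hz]
      abel
    · exact ⟨z, by rw [hz, coeff_gauge_monomial_of_not_subset h hIi]⟩

theorem cls_leaf_eq (hcc' : GaugeEquiv c c') (hc : IsDefiningSystem c) (hk : 2 ≤ k)
    (i : Fin k) : L.cls ((hcc'.isDefiningSystem hc).leaf hk i) = L.cls (hc.leaf hk i) := by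
  obtain ⟨z, hz⟩ := hcc'.exists_d_eq hc i
  have hd : weight n {i} + 0 = n i := by rw [weight_singleton, add_zero]
  refine (cls_eq_cls (n i) (by omega)).2 ⟨L.cast hd z, ?_⟩
  rw [L.d_cast (q := weight n {i} + -1) hd (by omega) (by rw [weight_singleton]; rfl), hz, map_sub]
  rfl

end GaugeEquiv

end Gauge

end Whitehead

/-! ### The universal defining system -/

namespace FreeLie

variable {X : Type u} {deg : X → ℤ}

section Lift

variable (G : GradedLie.{v}) (g : ∀ x, G.obj (deg x))

/-- Evaluation of a formal expression in a graded Lie algebra, given the values of the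
generators. -/
def preLift : ∀ {p : ℤ}, Pre X deg p → G.obj p
  | _, .of x h => G.cast h (g x)
  | _, .zero => 0
  | _, .add a b => preLift a + preLift b
  | _, .neg a => -preLift a
  | _, .smul c a => c • preLift a
  | _, .br h a b => G.bracket h (preLift a) (preLift b)

theorem preLift_congr {p : ℤ} {a b : Pre X deg p} (hab : Rel X deg a b) :
    preLift G g a = preLift G g b := by
  induction hab with
  | refl => rfl
  | symm _ ih => exact ih.symm
  | trans _ _ ih ih' => exact ih.trans ih'
  | add_congr _ _ ih ih' => simp only [preLift, ih, ih']
  | neg_congr _ ih => simp only [preLift, ih]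
  | smul_congr _ _ ih => simp only [preLift, ih]
  | br_congr _ _ _ ih ih' => simp only [preLift, ih, ih']
  | add_assoc => exact add_assoc _ _ _
  | add_comm => exact add_comm _ _
  | zero_add => exact zero_add _
  | neg_add => exact neg_add_cancel _
  | one_smul => exact one_smul _ _
  | mul_smul => exact mul_smul _ _ _
  | smul_add => exact smul_add _ _ _
  | add_smul => exact add_smul _ _ _
  | br_add_left => simp only [preLift, map_add, LinearMap.add_apply]
  | br_smul_left => simp only [preLift, map_smul, LinearMap.smul_apply]
  | br_add_right => simp only [preLift, map_add]
  | br_smul_right => simp only [preLift, map_smul]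
  | antisymm h _ _ _ => exact G.antisymm h _ _
  | jacobi hlm hmn hln h₁ h₂ h₃ _ _ _ => exact G.jacobi hlm hmn hln h₁ h₂ h₃ _ _ _

/-- The morphism from the free graded Lie algebra extending the map `g` on generators. -/
def lift (p : ℤ) : Obj X deg p →ₗ[ℚ] G.obj p where
  toFun := Quotient.lift (preLift G g) fun _ _ => preLift_congr G g
  map_add' := by rintro ⟨a⟩ ⟨b⟩; rfl
  map_smul' := by rintro c ⟨a⟩; rfl

variable {G g}

theorem lift_bracket {m n p : ℤ} (h : m + n = p) (x : Obj X deg m) (y : Obj X deg n) :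
    lift G g p (brk h x y) = G.bracket h (lift G g m x) (lift G g n y) := by
  obtain ⟨a, rfl⟩ := mk_surjective x
  obtain ⟨b, rfl⟩ := mk_surjective y
  rfl

end Lift

section Differential

variable {L : DGL.{v}} {g : ∀ x, L.obj (deg x)}
  {D : ∀ (x : X) (q : ℤ), q + 1 = deg x → Obj X deg q}

theorem lift_der (hg : ∀ x q hq, lift L.toGradedLie g q (D x q hq) = L.d _ q hq (g x))
    {p q : ℤ} (hq : q + 1 = p) (x : Obj X deg p) :
    lift L.toGradedLie g q (der D p q hq x) = L.d p q hq (lift L.toGradedLie g p x) := by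
  obtain ⟨a, rfl⟩ := mk_surjective x
  induction a generalizing q with
  | of x h => subst h; exact hg x q hq
  | zero => rw [show (mk .zero : Obj X deg _) = 0 from rfl]; simp only [map_zero]
  | add a b iha ihb => rw [mk_add]; simp only [map_add, iha, ihb]
  | neg a ih => rw [mk_neg]; simp only [map_neg, ih]
  | smul c a ih => rw [mk_smul]; simp only [map_smul, ih]
  | @br m n _ h a b iha ihb =>
    rw [mk_br, der_leibniz D h (m' := m - 1) (n' := n - 1) (by omega) (by omega) hq (by omega)
      (by omega), lift_bracket, L.leibniz h (m' := m - 1) (n' := n - 1) (by omega) (by omega) hq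
      (by omega) (by omega), map_add, map_smul, lift_bracket, lift_bracket, iha, ihb]

/-- The DGL morphism from a free DGL extending a map `g` on generators which is compatible with the
differentials of the generators. -/
def liftHom (hD : ∀ (x : X) (q r : ℤ) (hq : q + 1 = deg x) (hr : r + 1 = q),
      der D q r hr (D x q hq) = 0)
    (hg : ∀ x q hq, lift L.toGradedLie g q (D x q hq) = L.d _ q hq (g x)) :
    DGL.Hom (freeDGL X deg D hD) L where
  map := lift L.toGradedLie g
  map_bracket := lift_bracket
  map_d := lift_der hg

end Differential

end FreeLie

namespace Whitehead

open GradedLie DGL FreeLie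

variable {k : ℕ} (n : Fin k → ℤ)

section Universal

/-- The element `∑_I u_I e_I`, in which the defining systems of all higher Whitehead brackets
originate. -/
def universal : (conv n (lieU n)).obj (-1) := ofCoeff (tot n)

theorem weight_sub_two (I : Finset (Fin k)) : weight n I + -2 + 1 = gdeg n I := by
  unfold weight gdeg
  ring

/-- The element `∑_I (∂u_I) e_I`, where for `I = {1, …, k}` the formula for `∂u_I` gives `w`. -/
def universalBoundary : (conv n (lieU n)).obj (-2) :=
  ofCoeff fun I => bdry n I (weight n I + -2) (weight_sub_two n I)

theorem coeff_universal (I : Gen k) : coeff I.1 (universal n) = gen n I rfl :=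
  dif_pos I.2

theorem coeff_empty_universal : coeff ∅ (universal n) = 0 :=
  tot_empty n

theorem coeff_univ_universal : coeff Finset.univ (universal n) = 0 :=
  dif_neg fun h => h.2 rfl

theorem coeff_d_universal {I : Finset (Fin k)} (hI : I ≠ Finset.univ) :
    coeff I ((conv n (lieU n)).d (-1) (-2) (by norm_num) (universal n)) =
      coeff I (universalBoundary n) :=
  del_tot n hI _ _

theorem bracket_universal :
    (conv n (lieU n)).bracket (show (-1 : ℤ) + -1 = -2 by norm_num) (universal n) (universal n) =
      (-2 : ℚ) • universalBoundary n := by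
  refine conv_ext fun I => ?_
  have hb : (2 : ℚ) • coeff I (universalBoundary n) = ∑ J ∈ I.powerset, coef n J (I \ J) •
      (lieU n).bracketTo _ (coeff J (universal n)) (coeff (I \ J) (universal n)) := by
    refine (bdry_eq n I _ (weight_sub_two n I)).trans (Finset.sum_congr rfl fun J hJ => ?_)
    have hd : weight n J + -1 + (weight n (I \ J) + -1) = weight n I + -2 := by
      have := weight_sdiff n (Finset.mem_powerset.1 hJ)
      omega
    rw [bracketTo_eq hd]
    exact congrArg (coef n J (I \ J) • ·) (br0_eq n hd (tot n J) (tot n (I \ J)))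
  have hs (J : Finset (Fin k)) : convSign n (-1) J (I \ J) = -coef n J (I \ J) := by
    rw [convSign, coef, gdeg, ← weight, zpow_sub₀ (by norm_num), neg_one_mul, zpow_neg,
      ← inv_zpow, inv_neg_one]
    ring
  rw [map_smul, neg_smul, hb, ← Finset.sum_neg_distrib, coeff_bracket]
  exact Finset.sum_congr rfl fun J _ => by rw [hs, neg_smul]

theorem curvature_universal : curvature (universal n) =
    (conv n (lieU n)).d (-1) (-2) (by norm_num) (universal n) - universalBoundary n := by
  rw [curvature, bracket_universal]
  module

theorem isDefiningSystem_universal : IsDefiningSystem (universal n) where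
  coeff_empty := coeff_empty_universal n
  coeff_curvature I hI := by
    rw [curvature_universal, map_sub, coeff_d_universal n hI, sub_self]

theorem topCycle_universal : (isDefiningSystem_universal n).topCycle.1 = w n := by
  rw [IsDefiningSystem.coe_topCycle, curvature_universal, map_sub, coeff_d, coeff_univ_universal,
    map_zero, zero_sub, map_neg, neg_neg]
  rfl

variable {n} in
theorem cast_gen {p q : ℤ} (I : Gen k) (hp : gdeg n I.1 = p) (h : p = q) :
    (lieU n).cast h (gen n I hp) = gen n I (hp.trans h) := by
  subst h
  rfl

theorem leaf_universal (hk : 2 ≤ k) (i : Fin k) :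
    ((isDefiningSystem_universal n).leaf hk i).1 = u n hk i :=
  (congrArg ((lieU n).cast _) (coeff_universal n (single hk i))).trans (cast_gen _ rfl _)

end Universal

variable {n} {L : DGL.{u}}

section Evaluation

variable {c : (conv n L).obj (-1)}

/-- The morphism `𝕃(U) → L` of graded Lie algebras sending each `u_I` to the coefficient `c_I`. -/
def eval (c : (conv n L).obj (-1)) (p : ℤ) : (lieU n).obj p →ₗ[ℚ] L.obj p :=
  lift (deg := fun I : Gen k => gdeg n I.1) L.toGradedLie (fun I => coeff I.1 c) p

theorem eval_bracket {p q r : ℤ} (h : p + q = r) (x : (lieU n).obj p) (y : (lieU n).obj q) :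
    eval c r ((lieU n).bracket h x y) = L.bracket h (eval c p x) (eval c q y) :=
  lift_bracket h x y

theorem eval_coeff_universal (hc : coeff ∅ c = 0) {I : Finset (Fin k)} (hI : I ≠ Finset.univ) :
    eval c _ (coeff I (universal n)) = coeff I c := by
  obtain rfl | hI₀ := I.eq_empty_or_nonempty
  · rw [coeff_empty_universal, map_zero, hc]
  · rw [coeff_universal n ⟨I, hI₀, hI⟩]
    rfl

theorem eval_coeff_universalBoundary (hc : IsDefiningSystem c) {I : Finset (Fin k)}
    (hI : I ≠ Finset.univ) :
    eval c _ (coeff I (universalBoundary n)) = L.d _ _ (by omega) (coeff I c) := by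
  have hbr : eval c _ (coeff I ((conv n (lieU n)).bracket (show (-1 : ℤ) + -1 = -2 by norm_num)
      (universal n) (universal n))) =
      coeff I ((conv n L).bracket (show (-1 : ℤ) + -1 = -2 by norm_num) c c) := by
    refine (map_convBracket (eval c) eval_bracket (universal n) (universal n) I).trans ?_
    refine coeff_bracket_self_congr (x := ofCoeff fun J => eval c _ (coeff J (universal n)))
      (by norm_num) ?_ hc.coeff_empty fun J hJ => ?_
    · rw [coeff_ofCoeff, coeff_empty_universal, map_zero]
    · exact eval_coeff_universal hc.coeff_empty (hJ.trans_subset (Finset.subset_univ I)).ne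
  have hcurv := hc.coeff_curvature I hI
  rw [bracket_universal, map_smul, map_smul] at hbr
  rw [coeff_curvature, ← hbr] at hcurv
  linear_combination (norm := module) -hcurv

/-- The morphism `𝕃(U) → L` sending each `u_I` to the coefficient `c_I` of a defining system. -/
def IsDefiningSystem.hom (hc : IsDefiningSystem c) : Hom (lieU n) L :=
  liftHom _ fun I q hq => by
    obtain rfl : q = weight n I.1 + -2 := by have := weight_sub_two n I.1; omega
    exact eval_coeff_universalBoundary hc I.2.2

theorem IsDefiningSystem.coeff_convMap_hom (hc : IsDefiningSystem c) {I : Finset (Fin k)}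
    (hI : I ≠ Finset.univ) :
    coeff I ((Whitehead.convMap n hc.hom).map _ (universal n)) = coeff I c :=
  eval_coeff_universal hc.coeff_empty hI

end Evaluation

theorem mem_bracketSet_iff {hk : 2 ≤ k} {a : ∀ i, L.obj (n i - 1)}
    {z : L.H ((∑ i, n i) - 2)} :
    z ∈ bracketSet L hk n a ↔ ∃ (c : (conv n L).obj (-1)) (hc : IsDefiningSystem c),
      (∀ i, (hc.leaf hk i).1 = a i) ∧ hc.obstruction = z := by
  have hU := isDefiningSystem_universal n
  have hw (φ : Hom (lieU n) L) : (hU.convMap φ).obstruction =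
      L.cls ⟨φ.map _ (w n), φ.map_mem_cycles (w_mem_cycles n)⟩ := by
    rw [hU.obstruction_convMap]
    exact congrArg L.cls (Subtype.ext (congrArg (φ.map _) (topCycle_universal n)))
  constructor
  · rintro ⟨φ, hφ, rfl⟩
    refine ⟨_, hU.convMap φ, fun i => ?_, hw φ⟩
    rw [hU.leaf_convMap, leaf_universal, hφ]
  · rintro ⟨c, hc, hca, rfl⟩
    refine ⟨hc.hom, fun i => ?_, ?_⟩
    · rw [← leaf_universal, ← hU.leaf_convMap, ← hca]
      exact congrArg (L.cast _) (hc.coeff_convMap_hom (single hk i).2.2)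
    · rw [← hw]
      exact hc.obstruction_congr _ fun I hI => (hc.coeff_convMap_hom hI).symm

end Whitehead

/-! ### Invariance under quasi-isomorphisms -/

namespace DGL

theorem Hom.mapH_cls {A : DGL.{u}} {B : DGL.{v}} (f : Hom A B) {p : ℤ} (x : A.cycles p) :
    f.mapH p (A.cls x) = B.cls ⟨f.map p x.1, f.map_mem_cycles x.2⟩ :=
  rfl

theorem Hom.IsQuasiIso.exists_map_eq_add_d {A : DGL.{u}} {B : DGL.{v}} {f : Hom A B}
    (hf : f.IsQuasiIso) {p q r : ℤ} (hq : q + 1 = p) (hr : p + 1 = r) {e : A.obj q}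
    (he : e ∈ A.cycles q) {b : B.obj p} (hb : B.d p q hq b = f.map q e) :
    ∃ y h, A.d p q hq y = e ∧ f.map p y = b + B.d r p hr h := by
  have he₀ : f.mapH q (A.cls ⟨e, he⟩) = 0 := by
    rw [mapH_cls, cls_eq_zero, mem_boundaries p hq]
    exact ⟨b, hb⟩
  rw [map_eq_zero_iff _ (hf q).injective, cls_eq_zero, mem_boundaries p hq] at he₀
  obtain ⟨y, rfl⟩ := he₀
  have hby : b - f.map p y ∈ B.cycles p := by
    rw [mem_cycles q hq, map_sub, hb, f.map_d, sub_self]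
  obtain ⟨z, hz⟩ := (hf p).surjective (B.cls ⟨_, hby⟩)
  obtain ⟨z, rfl⟩ := A.cls_surjective z
  obtain ⟨h, hh⟩ := (cls_eq_cls r hr).1 hz
  replace hh : B.d r p hr h = f.map p z.1 - (b - f.map p y) := hh
  refine ⟨y + z.1, h, ?_, ?_⟩
  · rw [map_add, (mem_cycles q hq z.1).1 z.2, add_zero]
  · rw [hh, map_add]
    abel

end DGL

namespace Whitehead

open GradedLie DGL

variable {k : ℕ} {n : Fin k → ℤ}

section Representatives

variable {L : DGL.{u}} {c c' : (conv n L).obj (-1)}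

theorem IsDefiningSystem.leaf_congr (hc : IsDefiningSystem c) (hc' : IsDefiningSystem c')
    (hk : 2 ≤ k) {i : Fin k} (h : coeff {i} c = coeff {i} c') : hc.leaf hk i = hc'.leaf hk i :=
  Subtype.ext (congrArg (L.cast _) h)

theorem IsDefiningSystem.exists_gaugeEquiv_leaf_eq (hc : IsDefiningSystem c) {hk : 2 ≤ k}
    {a : ∀ i, L.cycles (n i - 1)} (ha : ∀ i, L.cls (hc.leaf hk i) = L.cls (a i)) :
    ∃ (c' : (conv n L).obj (-1)) (h : GaugeEquiv c c'),
      ∀ i, (h.isDefiningSystem hc).leaf hk i = a i := by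
  suffices ∀ s : Finset (Fin k), ∃ (c' : (conv n L).obj (-1)) (h : GaugeEquiv c c'),
      ∀ i ∈ s, (h.isDefiningSystem hc).leaf hk i = a i by
    obtain ⟨c', h, hc'⟩ := this Finset.univ
    exact ⟨c', h, fun i => hc' i (Finset.mem_univ i)⟩
  intro s
  induction s using Finset.induction_on with
  | empty => exact ⟨c, .refl, fun i hi => absurd hi (Finset.notMem_empty i)⟩
  | @insert i s his ih =>
    obtain ⟨c', hcc', hc'⟩ := ih
    obtain ⟨z, hz⟩ := (cls_eq_cls (n i) (by omega)).1
      ((ha i).symm.trans (hcc'.cls_leaf_eq hc hk i).symm)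
    have hd : n i = weight n {i} + 0 := by rw [weight_singleton, add_zero]
    refine ⟨_, hcc'.tail ⟨{i}, L.cast hd z, Finset.singleton_nonempty i, rfl⟩, fun j hj => ?_⟩
    obtain rfl | hji := eq_or_ne j i
    · refine Subtype.ext ((congrArg (L.cast _) (coeff_gauge_monomial_self _
        (hcc'.isDefiningSystem hc).coeff_empty)).trans ?_)
      rw [L.d_cast (q := n j - 1) hd (by omega) (by rw [weight_singleton]; rfl), hz, map_add]
      exact (congrArg _ ((L.cast _).apply_symm_apply _)).trans (add_sub_cancel _ _)
    · rw [← hc' j (Finset.mem_of_mem_insert_of_ne hj hji)]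
      refine IsDefiningSystem.leaf_congr _ _ hk (coeff_gauge_monomial_of_not_subset _ ?_)
      exact fun h => hji (Finset.mem_singleton.1 (Finset.singleton_subset_iff.1 h)).symm

/-- The higher Whitehead bracket set `[x₁, …, x_k]` of homology classes, in terms of defining
systems; no representing cycles are chosen. -/
def classBracketSet (L : DGL.{u}) (hk : 2 ≤ k) (n : Fin k → ℤ) (x : ∀ i, L.H (n i - 1)) :
    Set (L.H ((∑ i, n i) - 2)) :=
  {z | ∃ (c : (conv n L).obj (-1)) (hc : IsDefiningSystem c),
    (∀ i, L.cls (hc.leaf hk i) = x i) ∧ hc.obstruction = z}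

theorem bracketSet_eq_classBracketSet (hk : 2 ≤ k) (a : ∀ i, L.cycles (n i - 1)) :
    bracketSet L hk n (fun i => (a i).1) = classBracketSet L hk n (fun i => L.cls (a i)) := by
  refine Set.ext fun z => mem_bracketSet_iff.trans ⟨?_, ?_⟩
  · rintro ⟨c, hc, hca, rfl⟩
    exact ⟨c, hc, fun i => congrArg L.cls (Subtype.ext (hca i)), rfl⟩
  · rintro ⟨c, hc, hca, rfl⟩
    obtain ⟨c', hcc', hc'⟩ := hc.exists_gaugeEquiv_leaf_eq hca
    exact ⟨c', hcc'.isDefiningSystem hc, fun i => congrArg Subtype.val (hc' i),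
      hcc'.obstruction_eq hc⟩

end Representatives

section QuasiIso

variable {A : DGL.{u}} {B : DGL.{v}} {f : Hom A B}

/-- The induction hypothesis for lifting `b` along `f`: `c` satisfies the Maurer–Cartan equation
and lifts a gauge transform of `b`, in all proper components belonging to `T`. -/
structure IsPartialLift (f : Hom A B) (T : Finset (Finset (Fin k))) (b b' : (conv n B).obj (-1))
    (c : (conv n A).obj (-1)) : Prop where
  gaugeEquiv : GaugeEquiv b b'
  coeff_empty : coeff ∅ c = 0
  coeff_curvature : ∀ I ∈ T, I ≠ Finset.univ → coeff I (curvature c) = 0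
  map_coeff : ∀ I ∈ T, I ≠ Finset.univ → f.map _ (coeff I c) = coeff I b'

theorem IsPartialLift.d_coeff_eq {T : Finset (Finset (Fin k))} {b b' : (conv n B).obj (-1)}
    (hb : IsDefiningSystem b) {c : (conv n A).obj (-1)} (h : IsPartialLift f T b b' c)
    {I : Finset (Fin k)} (hI : I ≠ Finset.univ) (hT : ∀ J ⊂ I, J ∈ T) :
    B.d _ _ (by omega) (coeff I b') = f.map _ ((-(1 / 2) : ℚ) •
      coeff I ((conv n A).bracket (show (-1 : ℤ) + -1 = -2 by norm_num) c c)) := by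
  have hb' := h.gaugeEquiv.isDefiningSystem hb
  have hbr : coeff I ((conv n B).bracket (show (-1 : ℤ) + -1 = -2 by norm_num) _ _) =
      coeff I ((conv n B).bracket _ b' b') :=
    coeff_bracket_self_congr (x := (convMap n f).map _ c) (by norm_num)
      (by rw [coeff_convMap, h.coeff_empty, map_zero]) hb'.coeff_empty
      fun J hJ => h.map_coeff J (hT J hJ) (hJ.trans_subset (Finset.subset_univ I)).ne
  have hcurv := hb'.coeff_curvature I hI
  rw [Whitehead.coeff_curvature, ← hbr, ← (convMap n f).map_bracket, coeff_convMap] at hcurv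
  rw [map_smul]
  linear_combination (norm := module) hcurv

theorem IsPartialLift.extend (hf : f.IsQuasiIso) {T : Finset (Finset (Fin k))}
    {b b' : (conv n B).obj (-1)} (hb : IsDefiningSystem b) {c : (conv n A).obj (-1)}
    (h : IsPartialLift f T b b' c) {I : Finset (Fin k)} (hI : I ≠ Finset.univ) (hI₀ : I.Nonempty)
    (hT : ∀ J ⊂ I, J ∈ T) (hIT : ∀ J ∈ T, ¬ I ⊆ J) :
    ∃ b'' c', IsPartialLift f (insert I T) b b'' c' := by
  have hb' := h.gaugeEquiv.isDefiningSystem hb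
  have hcyc := (A.cycles _).smul_mem (-(1 / 2) : ℚ) <| coeff_bracket_self_mem_cycles
    h.coeff_empty fun J hJ =>
      h.coeff_curvature J (hT J hJ) (hJ.trans_subset (Finset.subset_univ I)).ne
  obtain ⟨y, g, hy, hyg⟩ := hf.exists_map_eq_add_d (r := weight n I + 0) _ (by omega) hcyc
    (h.d_coeff_eq hb hI hT)
  set c' := c + monomial I (y - coeff I c)
  have hc'I : coeff I c' = y := by rw [map_add, coeff_monomial_self, add_sub_cancel]
  have hc' {J : Finset (Fin k)} (hJ : J ≠ I) : coeff J c' = coeff J c := by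
    rw [map_add, coeff_monomial_of_ne _ hJ, add_zero]
  have hc'₀ : coeff ∅ c' = 0 := (hc' hI₀.ne_empty.symm).trans h.coeff_empty
  refine ⟨gauge (monomial I g) b', c', h.gaugeEquiv.tail ⟨I, g, hI₀, rfl⟩, hc'₀, ?_, ?_⟩
  all_goals refine Finset.forall_mem_insert .. |>.2 ⟨fun _ => ?_, fun J hJ hJu => ?_⟩
  · rw [Whitehead.coeff_curvature, hc'I, hy, coeff_bracket_self_congr _ hc'₀ h.coeff_empty
      fun J hJ => hc' hJ.ne]
    module
  · rw [coeff_curvature_congr hc'₀ h.coeff_empty fun K hK => hc' fun e => hIT J hJ (e ▸ hK)]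
    exact h.coeff_curvature J hJ hJu
  · rw [hc'I, hyg, coeff_gauge_monomial_self g hb'.coeff_empty]
  · rw [hc' fun e => hIT J hJ e.ge, h.map_coeff J hJ hJu,
      coeff_gauge_monomial_of_not_subset g (hIT J hJ)]

theorem exists_isPartialLift (hf : f.IsQuasiIso) {b : (conv n B).obj (-1)}
    (hb : IsDefiningSystem b) (T : Finset (Finset (Fin k)))
    (hT : IsLowerSet (T : Set (Finset (Fin k)))) : ∃ b' c, IsPartialLift f T b b' c := by
  revert hT
  refine Finset.induction_on_max_value Finset.card T ?_ fun I T hIT hmax ih hT => ?_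
  · exact fun _ => ⟨b, 0, .refl, map_zero _, by simp, by simp⟩
  · have hIT' : ∀ J ∈ T, ¬ I ⊆ J := fun J hJ hIJ =>
      hIT (Finset.eq_of_subset_of_card_le hIJ (hmax J hJ) ▸ hJ)
    have hlt : ∀ J ⊂ I, J ∈ T := fun J hJ =>
      Finset.mem_of_mem_insert_of_ne (hT hJ.subset (Finset.mem_coe.2 <| Finset.mem_insert_self I T))
        hJ.ne
    obtain ⟨b', c, h⟩ := ih fun J K hKJ hJ => Finset.mem_of_mem_insert_of_ne
      (hT hKJ (Finset.mem_insert_of_mem hJ)) fun e => hIT' J hJ (e ▸ hKJ)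
    obtain rfl | hI₀ := I.eq_empty_or_nonempty
    · refine ⟨b', c, h.gaugeEquiv, h.coeff_empty, ?_, ?_⟩
      · exact (Finset.forall_mem_insert ..).2
          ⟨fun _ => coeff_empty_curvature h.coeff_empty, h.coeff_curvature⟩
      · refine (Finset.forall_mem_insert ..).2 ⟨fun _ => ?_, h.map_coeff⟩
        rw [h.coeff_empty, (h.gaugeEquiv.isDefiningSystem hb).coeff_empty, map_zero]
    by_cases hI : I = Finset.univ
    · refine ⟨b', c, h.gaugeEquiv, h.coeff_empty, ?_, ?_⟩
      · exact (Finset.forall_mem_insert ..).2 ⟨fun h => absurd hI h, h.coeff_curvature⟩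
      · exact (Finset.forall_mem_insert ..).2 ⟨fun h => absurd hI h, h.map_coeff⟩
    · exact h.extend hf hb hI hI₀ hlt hIT'

theorem IsDefiningSystem.mapH_cls_leaf {c : (conv n A).obj (-1)} (hc : IsDefiningSystem c)
    (f : Hom A B) (hk : 2 ≤ k) (i : Fin k) :
    f.mapH _ (A.cls (hc.leaf hk i)) = B.cls ((hc.convMap f).leaf hk i) :=
  congrArg B.cls (Subtype.ext (hc.leaf_convMap f hk i).symm)

theorem IsDefiningSystem.exists_gaugeEquiv_convMap (hf : f.IsQuasiIso)
    {b : (conv n B).obj (-1)} (hb : IsDefiningSystem b) :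
    ∃ (b' : (conv n B).obj (-1)) (c : (conv n A).obj (-1)), GaugeEquiv b b' ∧
      IsDefiningSystem c ∧
      ∀ I ≠ Finset.univ, coeff I ((Whitehead.convMap n f).map _ c) = coeff I b' := by
  obtain ⟨b', c, h⟩ := exists_isPartialLift hf hb Finset.univ (by simp [isLowerSet_univ])
  exact ⟨b', c, h.gaugeEquiv, ⟨h.coeff_empty, fun I => h.coeff_curvature I (Finset.mem_univ I)⟩,
    fun I => h.map_coeff I (Finset.mem_univ I)⟩

theorem classBracketSet_mapH (hf : f.IsQuasiIso) (hk : 2 ≤ k) (x : ∀ i, A.H (n i - 1)) :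
    classBracketSet B hk n (fun i => f.mapH _ (x i)) = f.mapH _ '' classBracketSet A hk n x := by
  refine Set.Subset.antisymm ?_ ?_
  · rintro _ ⟨b, hb, hbx, rfl⟩
    obtain ⟨b', c, hbb', hc, hcb'⟩ := hb.exists_gaugeEquiv_convMap hf
    have hb' := hbb'.isDefiningSystem hb
    refine ⟨hc.obstruction, ⟨c, hc, fun i => (hf _).injective ?_, rfl⟩, ?_⟩
    · rw [hc.mapH_cls_leaf, (hc.convMap f).leaf_congr hb' hk (hcb' _ (single hk i).2.2),
        hbb'.cls_leaf_eq hb, hbx]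
    · rw [← hc.obstruction_convMap, (hc.convMap f).obstruction_congr hb' hcb',
        hbb'.obstruction_eq hb]
  · rintro _ ⟨_, ⟨c, hc, hcx, rfl⟩, rfl⟩
    exact ⟨_, hc.convMap f, fun i => by rw [← hc.mapH_cls_leaf, hcx], hc.obstruction_convMap f⟩

end QuasiIso

theorem zero_mem_bracketSet {L : DGL.{u}} (hd : ∀ p q h, L.d p q h = 0) {hk : 2 ≤ k} (hk₃ : 3 ≤ k)
    {a : ∀ i, L.obj (n i - 1)} (hne : (bracketSet L hk n a).Nonempty) :
    0 ∈ bracketSet L hk n a := by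
  obtain ⟨z, hz⟩ := hne
  obtain ⟨c, hc, hca, -⟩ := mem_bracketSet_iff.1 hz
  set c' : (conv n L).obj (-1) := ofCoeff fun I => if I.card = 1 then coeff I c else 0
  have hcoeff (I : Finset (Fin k)) : coeff I c' = if I.card = 1 then coeff I c else 0 := rfl
  have hc'₀ : coeff ∅ c' = 0 := by rw [hcoeff, Finset.card_empty, if_neg zero_ne_one]
  have hF : curvature c' = 0 := by
    refine conv_ext fun I => ?_
    rw [coeff_curvature, hd, LinearMap.zero_apply, zero_add, map_zero]
    by_cases hI : I.card = 2
    · have hcI := hc.coeff_curvature I fun hu => by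
        rw [hu, Finset.card_fin] at hI
        omega
      rw [coeff_curvature, hd, LinearMap.zero_apply, zero_add] at hcI
      rw [coeff_bracket_self_congr _ hc'₀ hc.coeff_empty fun J hJ => ?_, hcI]
      obtain hJ | hJ : J.card = 0 ∨ J.card = 1 := by have := Finset.card_lt_card hJ; omega
      · rw [Finset.card_eq_zero.1 hJ, hc'₀, hc.coeff_empty]
      · rw [hcoeff, if_pos hJ]
    · rw [coeff_bracket_eq_zero _ fun J hJ => ?_, smul_zero]
      by_contra! h
      have hJ₁ : J.card = 1 := by_contra fun hJ => h.1 (if_neg hJ)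
      have hJ₂ : (I \ J).card = 1 := by_contra fun hJ => h.2 (if_neg hJ)
      have := Finset.card_sdiff_add_card_eq_card hJ
      omega
  have hc' : IsDefiningSystem c' := ⟨hc'₀, fun I _ => by rw [hF, map_zero]⟩
  refine mem_bracketSet_iff.2 ⟨c', hc', fun i => ?_, ?_⟩
  · rw [hc'.leaf_congr hc, hca]
    rw [hcoeff, if_pos (Finset.card_singleton i)]
  · refine (congrArg L.cls (Subtype.ext ?_)).trans (map_zero _)
    rw [hc'.coe_topCycle, hF, map_zero, map_zero, neg_zero]
    rfl

end Whitehead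

namespace DGL

open Whitehead

/-- An isomorphism of the homology Lie algebras of two DGLs under which their higher Whitehead
bracket sets correspond. -/
structure WhiteheadEquiv (A : DGL.{u}) (B : DGL.{v}) where
  toEquiv (p : ℤ) : A.H p ≃ₗ[ℚ] B.H p
  map_homologyBracket {p q r : ℤ} (h : p + q = r) (x : A.H p) (y : A.H q) :
    toEquiv r (A.homologyBracket h x y) = B.homologyBracket h (toEquiv p x) (toEquiv q y)
  map_classBracketSet {k : ℕ} (hk : 2 ≤ k) (n : Fin k → ℤ) (x : ∀ i, A.H (n i - 1)) :
    classBracketSet B hk n (fun i => toEquiv _ (x i)) = toEquiv _ '' classBracketSet A hk n x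

namespace WhiteheadEquiv

variable {A : DGL.{u}} {B : DGL.{v}} {C : DGL.{w}}

/-- The identity. -/
def refl (A : DGL.{u}) : WhiteheadEquiv A A where
  toEquiv p := .refl ℚ (A.H p)
  map_homologyBracket _ _ _ := rfl
  map_classBracketSet _ _ _ := (Set.image_id _).symm

/-- The inverse correspondence. -/
def symm (E : WhiteheadEquiv A B) : WhiteheadEquiv B A where
  toEquiv p := (E.toEquiv p).symm
  map_homologyBracket h x y := by
    rw [LinearEquiv.symm_apply_eq, E.map_homologyBracket, LinearEquiv.apply_symm_apply,
      LinearEquiv.apply_symm_apply]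
  map_classBracketSet hk n x := by
    have := E.map_classBracketSet hk n fun i => (E.toEquiv _).symm (x i)
    simp only [LinearEquiv.apply_symm_apply] at this
    rw [this, Set.image_image]
    simp only [LinearEquiv.symm_apply_apply, Set.image_id']

/-- The composite correspondence. -/
def trans (E : WhiteheadEquiv A B) (F : WhiteheadEquiv B C) : WhiteheadEquiv A C where
  toEquiv p := (E.toEquiv p).trans (F.toEquiv p)
  map_homologyBracket h x y := by
    simp only [LinearEquiv.trans_apply, E.map_homologyBracket, F.map_homologyBracket]
  map_classBracketSet hk n x := by
    simp only [LinearEquiv.trans_apply, F.map_classBracketSet, E.map_classBracketSet,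
      Set.image_image]
    rfl

/-- The correspondence induced by a quasi-isomorphism. -/
noncomputable def ofIsQuasiIso {f : Hom A B} (hf : f.IsQuasiIso) : WhiteheadEquiv A B where
  toEquiv p := .ofBijective (f.mapH p) (hf p)
  map_homologyBracket h x y := by
    obtain ⟨x, rfl⟩ := A.cls_surjective x
    obtain ⟨y, rfl⟩ := A.cls_surjective y
    simp only [LinearEquiv.ofBijective_apply, homologyBracket_cls, Hom.mapH_cls]
    exact congrArg B.cls (Subtype.ext (f.map_bracket h x.1 y.1))
  map_classBracketSet hk n x := classBracketSet_mapH hf hk x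

end WhiteheadEquiv

theorem IsFormal.nonempty_whiteheadEquiv {L : DGL.{u}} (hL : L.IsFormal) :
    Nonempty (WhiteheadEquiv L L.homologyDGL) := by
  unfold IsFormal at hL
  generalize L.homologyDGL = K at hL
  induction hL with
  | rel A B h => exact ⟨.ofIsQuasiIso h.choose_spec⟩
  | refl A => exact ⟨.refl A⟩
  | symm A B _ ih => exact ih.map .symm
  | trans A B C _ _ ih₁ ih₂ => exact ⟨ih₁.some.trans ih₂.some⟩

section ZeroDifferential

variable {L : DGL.{u}} {p : ℤ}

theorem mem_cycles_of_d_eq_zero (hd : ∀ p q h, L.d p q h = 0) (x : L.obj p) : x ∈ L.cycles p := by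
  rw [mem_cycles (p - 1) (by omega), hd, LinearMap.zero_apply]

theorem bijective_cls_of_d_eq_zero (hd : ∀ p q h, L.d p q h = 0) (p : ℤ) :
    Function.Bijective (L.cls ∘ₗ LinearMap.id.codRestrict (L.cycles p)
      (mem_cycles_of_d_eq_zero hd)) := by
  refine ⟨(injective_iff_map_eq_zero _).2 fun x hx => ?_, fun z => ?_⟩
  · obtain ⟨y, hy⟩ := (mem_boundaries (p + 1) rfl x).1 ((L.cls_eq_zero _).1 hx)
    rw [← hy, hd, LinearMap.zero_apply]
  · obtain ⟨x, rfl⟩ := L.cls_surjective z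
    exact ⟨x.1, rfl⟩

/-- A graded Lie algebra, viewed as a DGL with zero differential, is its own homology. -/
noncomputable def clsEquiv (hd : ∀ p q h, L.d p q h = 0) (p : ℤ) : L.obj p ≃ₗ[ℚ] L.H p :=
  .ofBijective _ (bijective_cls_of_d_eq_zero hd p)

theorem clsEquiv_bracket (hd : ∀ p q h, L.d p q h = 0) {q r : ℤ} (h : p + q = r) (x : L.obj p)
    (y : L.obj q) :
    clsEquiv hd r (L.bracket h x y) = L.homologyBracket h (clsEquiv hd p x) (clsEquiv hd q y) :=
  rfl

variable {K : DGL.{v}} (hL : ∀ p q h, L.d p q h = 0) (hK : ∀ p q h, K.d p q h = 0)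
  (g : ∀ p, K.obj p ≃ₗ[ℚ] L.H p)
  (hg : ∀ {p q r : ℤ} (h : p + q = r) (x : K.obj p) (y : K.obj q),
    g r (K.bracket h x y) = L.homologyBracket h (g p x) (g q y))

/-- The morphism of DGLs with zero differential given by an isomorphism `g : K ≃ H_*(L) = L` of
graded Lie algebras. -/
noncomputable def homOfEquivHomology : Hom K L where
  map p := (g p).trans (clsEquiv hL p).symm
  map_bracket h x y := by
    refine (clsEquiv hL _).symm_apply_eq.2 ?_
    simp only [clsEquiv_bracket, LinearEquiv.coe_coe, LinearEquiv.trans_apply,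
      LinearEquiv.apply_symm_apply, hg]
  map_d h x := by rw [hK, hL, LinearMap.zero_apply, LinearMap.zero_apply, map_zero]

theorem mapH_homOfEquivHomology (x : K.obj p) :
    (homOfEquivHomology hL hK g hg).mapH p (clsEquiv hK p x) = g p x :=
  (clsEquiv hL p).apply_symm_apply (g p x)

theorem isQuasiIso_homOfEquivHomology : (homOfEquivHomology hL hK g hg).IsQuasiIso := by
  intro p
  have h : (homOfEquivHomology hL hK g hg).mapH p = (clsEquiv hK p).symm.trans (g p) := by
    refine LinearMap.ext fun z => ?_
    obtain ⟨x, rfl⟩ := (clsEquiv hK p).surjective z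
    rw [mapH_homOfEquivHomology, LinearEquiv.coe_coe, LinearEquiv.trans_apply,
      LinearEquiv.symm_apply_apply]
  rw [h]
  exact LinearEquiv.bijective _

theorem WhiteheadEquiv.exists_toEquiv_eq_clsEquiv (E : WhiteheadEquiv L K)
    (hg : ∀ {p q r : ℤ} (h : p + q = r) (x : K.obj p) (y : K.obj q),
      g r (K.bracket h x y) = L.homologyBracket h (g p x) (g q y)) :
    ∃ F : WhiteheadEquiv L K, ∀ p x, F.toEquiv p (g p x) = clsEquiv hK p x := by
  have hgE {p q r : ℤ} (h : p + q = r) (x : K.obj p) (y : K.obj q) :=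
    (congrArg _ (hg h x y)).trans (E.map_homologyBracket h (g p x) (g q y))
  have hf := isQuasiIso_homOfEquivHomology hK hK (fun p => (g p).trans (E.toEquiv p)) hgE
  refine ⟨E.trans (ofIsQuasiIso hf).symm, fun p x => (LinearEquiv.symm_apply_eq _).2 ?_⟩
  exact (mapH_homOfEquivHomology hK hK (fun p => (g p).trans (E.toEquiv p)) hgE x).symm

end ZeroDifferential

theorem d_homologyDGL (L : DGL.{u}) (p q : ℤ) (h : q + 1 = p) : L.homologyDGL.d p q h = 0 :=
  rfl

theorem IsFormal.exists_bracketSet_homologyDGL_eq {L : DGL.{u}} (hL : L.IsFormal) {k : ℕ}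
    (hk : 2 ≤ k) {n : Fin k → ℤ} (a : ∀ i, L.cycles (n i - 1)) :
    ∃ e : L.H ((∑ i, n i) - 2) ≃ₗ[ℚ] L.homologyDGL.H ((∑ i, n i) - 2),
      bracketSet L.homologyDGL hk n (fun i => L.cls (a i)) =
        e '' bracketSet L hk n (fun i => (a i).1) := by
  obtain ⟨E⟩ := hL.nonempty_whiteheadEquiv
  obtain ⟨F, hF⟩ := E.exists_toEquiv_eq_clsEquiv L.d_homologyDGL (fun p => .refl ℚ (L.H p))
    fun _ _ _ => rfl
  refine ⟨F.toEquiv _, (bracketSet_eq_classBracketSet hk fun i =>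
    ⟨L.cls (a i), mem_cycles_of_d_eq_zero L.d_homologyDGL _⟩).trans ?_⟩
  rw [bracketSet_eq_classBracketSet, ← F.map_classBracketSet]
  exact congrArg _ (funext fun i => (hF _ (L.cls (a i))).symm)

end DGL

theorem theorem1p7 (L : DGL.{u}) (k : ℕ) (hk : 2 ≤ k) (n : Fin k → ℤ)
    (x : ∀ i, L.H (n i - 1))
    (a : ∀ i, L.cycles (n i - 1)) (ha : ∀ i, L.cls (a i) = x i)
    (hne : (Whitehead.bracketSet L hk n (fun i => (a i).1)).Nonempty)
    (h : (3 ≤ k ∧ 0 ∉ Whitehead.bracketSet L hk n (fun i => (a i).1)) ∨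
      ¬ Nonempty (Whitehead.bracketSet L hk n (fun i => (a i).1) ≃
        Whitehead.bracketSet L.homologyDGL hk n x)) :
    ¬ L.IsFormal := by
  intro hL
  obtain rfl : (fun i => L.cls (a i)) = x := funext ha
  obtain ⟨e, he⟩ := hL.exists_bracketSet_homologyDGL_eq hk a
  obtain ⟨hk₃, h₀⟩ | hbij := h
  · have h₀H := Whitehead.zero_mem_bracketSet L.d_homologyDGL hk₃ (he ▸ hne.image e)
    rw [he, ← map_zero e, e.injective.mem_set_image] at h₀H
    exact h₀ h₀H
  · exact hbij ⟨(e.toEquiv.image _).trans (.setCongr he.symm)⟩
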